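/- Conventions. $\tau=x+iy\in\mathbb H$, $T=\left(\begin{smallmatrix}1&1\\0&1\end{smallmatrix}\right)$ and $\gamma=\left(\begin{smallmatrix}a&b\\c&d\end{smallmatrix}\right)\in\mathrm{SL}_2(\mathbb Z)$. Real powers $(c\tau+d)^{a}$ are taken with the principal branch, and $(c\overline\tau+d)^{a}$ denotes the complex conjugate of $(c\tau+d)^{a}$. A multiplier system of weight $w\in\mathbb R$ is a map $\chi:\mathrm{SL}_2(\mathbb Z)\to\mathbb C$ with $|\chi(\gamma)|=1$ and $$\chi(\gamma_1\gamma_2)\,j(\gamma_1\gamma_2,\tau)^w=\chi(\gamma_1)\chi(\gamma_2)\,j(\gamma_1,\gamma_2\tau)^w j(\gamma_2,\tau)^w,\qquad j(\gamma,\tau)=c\tau+d.$$ A modular form of weight $l\in\mathbb R$ and multiplier system $\chi$ is a holomorphic $g:\mathbb H\to\mathbb C$ with $\chi(\gamma)^{-1}(c\tau+d)^{-l}g(\gamma\tau)=g(\tau)$ for all $\gamma\in\mathrm{SL}_2(\mathbb Z)$ and $g(\tau)=\sum_{n\ge0}a(n+\kappa)e^{2\pi i(n+\kappa)\tau}$,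 where $\kappa\in[0,1)$ and $\chi(T)=e^{2\pi i\kappa}$. Let $m$ be a positive integer and $k\in\mathbb R$. The space $J^{sk}_{k,m,\chi}$ of skew-holomorphic Jacobi forms consists of the functions $f:\mathbb H\times\mathbb C\to\mathbb C$, real analytic in $\tau\in\mathbb H$ and holomorphic in $z\in\mathbb C$, such that for all $\gamma\in\mathrm{SL}_2(\mathbb Z)$ and $\lambda,\mu\in\mathbb Z$ $$\chi(\gamma)^{-1}f\Big(\gamma\tau,\tfrac{z+\lambda\tau+\mu}{c\tau+d}\Big)(c\overline\tau+d)^{1-k}|c\tau+d|^{-1}\exp\Big(2\pi i m\Big(-\tfrac{c(z+\lambda\tau+\mu)^2}{c\tau+d}+\lambda^2\tau+2\lambda z\Big)\Big)=f(\tau,z),$$ and such that for some $\kappa\in[0,1)$ there is an absolutely convergent expansion $$f(\tau,z)=\sum_{\substack{n,r\in\mathbb Z\\ r^2-4m(n+\kappa)\ge0}}d(n+\kappa,r)\exp\Big(-\tfrac{\pi y}{m}\big(r^2-4m(n+\kappa)\big)\Big)e^{2\pi i(n+\kappa)\tau}e^{2\pi i rz}.$$ Such an $f$ is a skew-holomorphic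 Jacobi cusp form, $f\in J^{sk,cusp}_{k,m,\chi}$, if moreover $d(n+\kappa,r)=0$ whenever $r^2-4m(n+\kappa)=0$. For $D_{-\overline\tau}:=\frac1{2\pi i}\frac{\partial}{\partial(-\overline\tau)}=-\frac{1}{2\pi i}\frac{\partial}{\partial\overline\tau}$ and an integer $\nu\ge1$ put $$[f,g]^{\mathrm{skew}}_{k,l,\nu}(\tau,z):=\sum_{r+s=\nu}(-1)^r\binom{\nu+k-3/2}{s}\binom{\nu+l-1}{r}D^r_{-\overline\tau}(f(\tau,z))\,D^s_{-\overline\tau}(\overline{g(\tau)}),$$ where $\binom{x}{s}=x(x-1)\cdots(x-s+1)/s!$. Proposition. Let $m,\nu$ be positive integers and $k,l,w\in\mathbb R$. Let $\chi_1$ be a multiplier system of some weight $w$ and $\chi_2$ a multiplier system of weight $l$ on $\mathrm{SL}_2(\mathbb Z)$. Let $f\in J^{sk}_{k,m,\chi_1}$ and let $g$ be a modular form of weight $l$ and multiplier system $\chi_2$. Then $\chi_1\overline{\chi_2}$ is a multiplier system of weight $w-l$, and $$[f,g]^{\mathrm{skew}}_{k,l,\nu}\in J^{sk,cusp}_{k+l+2\nu,\,m,\,\chi_1\overline{\chi_2}}.$$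 -/

import Mathlib

open UpperHalfPlane MatrixGroups ComplexConjugate

noncomputable section

namespace SkewJacobi

/-- The automorphy factor `j(γ, τ) = c τ + d` of `γ = (a b; c d)`. -/
def autFactor (γ : SL(2, ℤ)) (τ : ℍ) : ℂ :=
  ((γ 1 0 : ℤ) : ℂ) * (τ : ℂ) + ((γ 1 1 : ℤ) : ℂ)

/-- `χ` is a (unitary) multiplier system of real weight `k` on `SL(2, ℤ)`; real powers of `c τ + d`
are taken with the principal branch. -/
structure IsMultiplierSystem (k : ℝ) (χ : SL(2, ℤ) → ℂ) : Prop where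
  norm_eq_one : ∀ γ, ‖χ γ‖ = 1
  cocycle : ∀ (γ₁ γ₂ : SL(2, ℤ)) (τ : ℍ),
    χ (γ₁ * γ₂) * autFactor (γ₁ * γ₂) τ ^ (k : ℂ) =
      χ γ₁ * χ γ₂ * autFactor γ₁ (γ₂ • τ) ^ (k : ℂ) * autFactor γ₂ τ ^ (k : ℂ)

/-- `g` is a modular form of real weight `l` and multiplier system `χ` on `SL(2, ℤ)`: it is
holomorphic on `ℍ`, invariant under the slash action, and has an expansion
`∑_{n ≥ 0} a(n + κ) exp (2 π i (n + κ) τ)` where `χ(T) = exp (2 π i κ)`, `0 ≤ κ < 1`. -/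
structure IsModularForm (l : ℝ) (χ : SL(2, ℤ) → ℂ) (g : ℍ → ℂ) : Prop where
  holomorphic : DifferentiableOn ℂ (fun w : ℂ => g (ofComplex w)) {w : ℂ | 0 < w.im}
  slash_invariant : ∀ (γ : SL(2, ℤ)) (τ : ℍ),
    (χ γ)⁻¹ * autFactor γ τ ^ (-(l : ℂ)) * g (γ • τ) = g τ
  fourier : ∃ κ : ℝ, 0 ≤ κ ∧ κ < 1 ∧
    χ ModularGroup.T = Complex.exp (2 * Real.pi * Complex.I * κ) ∧
    ∃ a : ℕ → ℂ, ∀ τ : ℍ,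
      HasSum (fun n : ℕ => a n * Complex.exp (2 * Real.pi * Complex.I * ((n : ℂ) + κ) * τ)) (g τ)

/-- The action of `[γ, (lam, mu)]` in the Jacobi group `SL(2, ℤ) ⋉ ℤ²` on functions on `ℍ × ℂ`
which is used for skew-holomorphic forms of weight `k`, index `m` and multiplier system `χ`.
The power `(c τ̄ + d) ^ (1 - k)` is the complex conjugate of the principal value of
`(c τ + d) ^ (1 - k)`. -/
def skewSlash (k : ℝ) (m : ℕ) (χ : SL(2, ℤ) → ℂ) (γ : SL(2, ℤ)) (lam mu : ℤ)
    (f : ℍ → ℂ → ℂ) (τ : ℍ) (z : ℂ) : ℂ :=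
  (χ γ)⁻¹ * f (γ • τ) ((z + lam * (τ : ℂ) + mu) / autFactor γ τ)
    * conj (autFactor γ τ ^ (1 - (k : ℂ)))
    * ((‖autFactor γ τ‖ : ℝ) : ℂ)⁻¹
    * Complex.exp (2 * Real.pi * Complex.I * m *
        (-(((γ 1 0 : ℤ) : ℂ) * (z + lam * (τ : ℂ) + mu) ^ 2 / autFactor γ τ)
          + (lam : ℂ) ^ 2 * (τ : ℂ) + 2 * lam * z))

/-- `f` is the sum of the (absolutely convergent) series over all `n, r ∈ ℤ` with
`r² - 4 m (n + κ) ≥ 0` of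
`d(n + κ, r) exp (-(π y / m) (r² - 4 m (n + κ))) exp (2 π i (n + κ) τ) exp (2 π i r z)`,
where `y = Im τ`. The coefficient `d(n + κ, r)` is written `d n r`. -/
def HasSkewExpansion (m : ℕ) (κ : ℝ) (d : ℤ → ℤ → ℂ) (f : ℍ → ℂ → ℂ) : Prop :=
  (∀ n r : ℤ, (r : ℝ) ^ 2 - 4 * m * (n + κ) < 0 → d n r = 0) ∧
  ∀ (τ : ℍ) (z : ℂ), HasSum
    (fun p : ℤ × ℤ => d p.1 p.2
      * Complex.exp (((-(Real.pi * τ.im / m) * ((p.2 : ℝ) ^ 2 - 4 * m * (p.1 + κ)) : ℝ)) : ℂ)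
      * Complex.exp (2 * Real.pi * Complex.I * ((p.1 : ℂ) + κ) * τ)
      * Complex.exp (2 * Real.pi * Complex.I * p.2 * z))
    (f τ z)

/-- The part of the definition of skew-holomorphic Jacobi forms that does not concern the Fourier
expansion: `f(τ, z)` is real analytic in `τ`, holomorphic in `z` and invariant under the Jacobi
group. -/
structure IsSkewInvariant (k : ℝ) (m : ℕ) (χ : SL(2, ℤ) → ℂ) (f : ℍ → ℂ → ℂ) : Prop where
  analytic : ∀ z : ℂ, AnalyticOnNhd ℝ (fun w : ℂ => f (ofComplex w) z) {w : ℂ | 0 < w.im}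
  holomorphic : ∀ τ : ℍ, Differentiable ℂ (f τ)
  slash_invariant : ∀ (γ : SL(2, ℤ)) (lam mu : ℤ) (τ : ℍ) (z : ℂ),
    skewSlash k m χ γ lam mu f τ z = f τ z

/-- Skew-holomorphic Jacobi forms of weight `k`, index `m` and multiplier system `χ`. -/
structure IsSkewJacobiForm (k : ℝ) (m : ℕ) (χ : SL(2, ℤ) → ℂ) (f : ℍ → ℂ → ℂ) : Prop
    extends IsSkewInvariant k m χ f where
  fourier : ∃ κ : ℝ, 0 ≤ κ ∧ κ < 1 ∧ ∃ d : ℤ → ℤ → ℂ, HasSkewExpansion m κ d f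

/-- Skew-holomorphic Jacobi cusp forms: moreover `d(n + κ, r) = 0` if `r² - 4 m (n + κ) = 0`. -/
structure IsSkewJacobiCuspForm (k : ℝ) (m : ℕ) (χ : SL(2, ℤ) → ℂ) (f : ℍ → ℂ → ℂ) : Prop
    extends IsSkewInvariant k m χ f where
  fourier : ∃ κ : ℝ, 0 ≤ κ ∧ κ < 1 ∧ ∃ d : ℤ → ℤ → ℂ, HasSkewExpansion m κ d f ∧
    ∀ n r : ℤ, (r : ℝ) ^ 2 - 4 * m * (n + κ) = 0 → d n r = 0

/-- The Wirtinger derivative `∂/∂τ̄ = (∂/∂x + i ∂/∂y) / 2` of a function on `ℍ`. -/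
def wirtingerBar (F : ℍ → ℂ) (τ : ℍ) : ℂ :=
  (1 / 2) * (fderiv ℝ (fun w : ℂ => F (ofComplex w)) (τ : ℂ) 1
    + Complex.I * fderiv ℝ (fun w : ℂ => F (ofComplex w)) (τ : ℂ) Complex.I)

/-- `D_{-τ̄} = (1 / (2 π i)) ∂/∂(-τ̄)`. -/
def antiD (F : ℍ → ℂ) (τ : ℍ) : ℂ :=
  -(1 / (2 * Real.pi * Complex.I)) * wirtingerBar F τ

/-- The extended Rankin–Cohen bracket `[f, g]^skew_{k, l, ν}`. The binomial coefficients with real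
upper entry are the polynomial ones, `x (x - 1) ⋯ (x - s + 1) / s!`. -/
def skewBracket (k l : ℝ) (ν : ℕ) (f : ℍ → ℂ → ℂ) (g : ℍ → ℂ) (τ : ℍ) (z : ℂ) : ℂ :=
  ∑ p ∈ Finset.HasAntidiagonal.antidiagonal ν,
    (-1 : ℂ) ^ p.1
      * ((Ring.choose ((ν : ℝ) + k - 3 / 2) p.2 : ℝ) : ℂ)
      * ((Ring.choose ((ν : ℝ) + l - 1) p.1 : ℝ) : ℂ)
      * antiD^[p.1] (fun τ' => f τ' z) τ
      * antiD^[p.2] (fun τ' => conj (g τ')) τ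

end SkewJacobi

end

/-! Solved for `f (γ • τ)`, the Jacobi transformation law has automorphy factor `|cτ+d|
(cτ̄+d)^(k-1)`, which equals `(cτ+d)^(1/2)` times the conjugate of `(cτ+d)^(k-1/2)`. The half power
and the Jacobi exponential are holomorphic in `τ`, so `D_{-τ̄}` does not see them: in the variable
`τ̄`, `f` has weight `K = k - 1/2` and `conj g` has weight `l`. The bracket is then an ordinary
Rankin–Cohen bracket in `τ̄`.

Let `e` be the logarithmic derivative of `cτ̄+d` (`antiShift`); it satisfies `D e = -e²`. By
`deriv_transformation` the `r`-th derivative of a weight `K` function picks up `(cτ̄+d)^(K+2r)` and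
becomes a polynomial `P_r(e)` with `P_r(0)` the derivative itself and `P_(r+1)' = (r+1)(K+r) P_r`.
The bracket coefficients are exactly those for which the sum of products of such polynomials has
zero derivative in `e` (`sum_bracketCoeff_derivPoly`), so the sum equals its value at `e = 0`.

For the expansion, each term is written `exp(2πi(pτ - qτ̄ + ρz))` with `p, q ≥ 0`, and `D_{-τ̄}`
multiplies it by `q`. Replacing `τ, τ̄, z` by independent complex variables reduces termwise
differentiation to holomorphic series (`Admissible.hasFDerivAt`). In the product the exponents `q`
add, so total `q = 0` forces both factors to have `q = 0`; since `ν > 0`, every summand of the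
bracket then contains a positive power of zero. This gives cuspidality (`exists_cusp_expansion`). -/

noncomputable section

namespace SkewJacobi

/-! ### Calculus of the Wirtinger operator `D_{-τ̄}`. -/

/-- `F` is real differentiable at `τ` and `D_{-τ̄} F (τ) = F'`. -/
def HasAntiD (F : ℍ → ℂ) (F' : ℂ) (τ : ℍ) : Prop :=
  ∃ L : ℂ →L[ℝ] ℂ, HasFDerivAt (fun w : ℂ => F (ofComplex w)) L (τ : ℂ) ∧
    -(1 / (2 * Real.pi * Complex.I)) * ((1 / 2) * (L 1 + Complex.I * L Complex.I)) = F'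

theorem HasAntiD.antiD_eq {F : ℍ → ℂ} {F' : ℂ} {τ : ℍ} (h : HasAntiD F F' τ) :
    antiD F τ = F' := by
  obtain ⟨L, hL, rfl⟩ := h
  rw [antiD, wirtingerBar, hL.fderiv]

theorem HasAntiD.unique {F : ℍ → ℂ} {a b : ℂ} {τ : ℍ} (ha : HasAntiD F a τ)
    (hb : HasAntiD F b τ) : a = b :=
  ha.antiD_eq.symm.trans hb.antiD_eq

theorem HasAntiD.mul {F G : ℍ → ℂ} {F' G' : ℂ} {τ : ℍ} (hF : HasAntiD F F' τ)
    (hG : HasAntiD G G' τ) : HasAntiD (fun τ => F τ * G τ) (F' * G τ + F τ * G') τ := by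
  obtain ⟨L, hL, rfl⟩ := hF
  obtain ⟨M, hM, rfl⟩ := hG
  refine ⟨_, hL.mul hM, ?_⟩
  simp only [ofComplex_apply, add_apply, smul_apply,
    smul_eq_mul]
  ring

theorem HasAntiD.sum {ι : Type*} {s : Finset ι} {F : ι → ℍ → ℂ} {F' : ι → ℂ} {τ : ℍ}
    (h : ∀ i ∈ s, HasAntiD (F i) (F' i) τ) :
    HasAntiD (fun τ => ∑ i ∈ s, F i τ) (∑ i ∈ s, F' i) τ := by
  choose! L hL hL' using h
  refine ⟨∑ i ∈ s, L i, HasFDerivAt.fun_sum hL, ?_⟩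
  rw [← Finset.sum_congr rfl hL']
  simp only [sum_apply, Finset.mul_sum, ← Finset.sum_add_distrib]

theorem eventually_im_pos (τ : ℍ) : ∀ᶠ w : ℂ in nhds (τ : ℂ), 0 < w.im :=
  (isOpen_lt continuous_const Complex.continuous_im).mem_nhds τ.im_pos

theorem HasAntiD.congr_deriv {F : ℍ → ℂ} {a b : ℂ} {τ : ℍ} (h : HasAntiD F a τ) (hab : a = b) :
    HasAntiD F b τ := hab ▸ h

/-- Holomorphic functions are killed by `D_{-τ̄}`. -/
theorem hasAntiD_of_hasDerivAt {h : ℂ → ℂ} {h' : ℂ} {τ : ℍ} (hh : HasDerivAt h h' τ) :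
    HasAntiD (fun τ => h τ) 0 τ := by
  refine ⟨_, (hh.hasFDerivAt.restrictScalars ℝ).congr_of_eventuallyEq ?_, ?_⟩
  · filter_upwards [eventually_im_pos τ] with w hw
    rw [ofComplex_apply_of_im_pos hw]
  · simp only [ContinuousLinearMap.coe_restrictScalars', ContinuousLinearMap.toSpanSingleton_apply,
      smul_eq_mul, one_mul, ← mul_assoc, Complex.I_mul_I]
    ring

theorem hasAntiD_const (c : ℂ) (τ : ℍ) : HasAntiD (fun _ => c) 0 τ :=
  hasAntiD_of_hasDerivAt (hasDerivAt_const (τ : ℂ) c)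

theorem hasAntiD_conj_of_hasDerivAt {h : ℂ → ℂ} {h' : ℂ} {τ : ℍ} (hh : HasDerivAt h h' τ) :
    HasAntiD (fun τ => conj (h τ)) (-(1 / (2 * Real.pi * Complex.I)) * conj h') τ := by
  refine ⟨_, ((Complex.conjCLE.toContinuousLinearMap.hasFDerivAt).comp (τ : ℂ)
    (hh.hasFDerivAt.restrictScalars ℝ)).congr_of_eventuallyEq ?_, ?_⟩
  · filter_upwards [eventually_im_pos τ] with w hw
    simp [ofComplex_apply_of_im_pos hw]
  · simp only [ContinuousLinearMap.comp_apply, ContinuousLinearMap.coe_restrictScalars',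
      ContinuousLinearMap.toSpanSingleton_apply, smul_eq_mul, one_mul,
      ContinuousLinearEquiv.coe_coe, Complex.conjCLE_apply, map_mul, Complex.conj_I]
    linear_combination (1 / (2 * Real.pi * Complex.I)) * (1/2) * conj h' * Complex.I_mul_I

/-- The chain rule for `Φ (A τ) (conj (B τ)) (C τ)` with `Φ` holomorphic in three variables. -/
theorem hasAntiD_comp₃ {Φ : ℂ × ℂ × ℂ → ℂ} {A B C : ℂ → ℂ} {A' B' C' : ℂ} {τ : ℍ}
    {L : ℂ × ℂ × ℂ →L[ℂ] ℂ}
    (hΦ : HasFDerivAt Φ L (A τ, conj (B τ), C τ))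
    (hA : HasDerivAt A A' τ) (hB : HasDerivAt B B' τ) (hC : HasDerivAt C C' τ) :
    HasAntiD (fun τ => Φ (A τ, conj (B τ), C τ))
      (-(1 / (2 * Real.pi * Complex.I)) * (conj B' * L (0, 1, 0))) τ := by
  have hB2 := (Complex.conjCLE.toContinuousLinearMap.hasFDerivAt).comp (τ : ℂ)
    (hB.hasFDerivAt.restrictScalars ℝ)
  have h3 := (hA.hasFDerivAt.restrictScalars ℝ).prodMk
    (hB2.prodMk (hC.hasFDerivAt.restrictScalars ℝ))
  refine ⟨_, (HasFDerivAt.comp (τ : ℂ) (f := fun w : ℂ => (A w, conj (B w), C w))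
    (hΦ.restrictScalars ℝ) h3).congr_of_eventuallyEq ?_, ?_⟩
  · filter_upwards [eventually_im_pos τ] with w hw
    simp [ofComplex_apply_of_im_pos hw]
  · simp only [ContinuousLinearMap.comp_apply, ContinuousLinearMap.coe_restrictScalars',
      ContinuousLinearMap.toSpanSingleton_apply, smul_eq_mul, one_mul,
      ContinuousLinearMap.prod_apply,
      ContinuousLinearEquiv.coe_coe, Complex.conjCLE_apply, map_mul, Complex.conj_I]
    congr 1
    -- Since `L` is complex linear, the holomorphic slots cancel (`v + I(Iv) = 0`) and the
    -- conjugated slot doubles.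
    have e1 : L (A', conj B', C') + Complex.I * L (Complex.I * A', -Complex.I * conj B',
        Complex.I * C') = L ((2 * conj B') • (0, 1, 0)) := by
      rw [← smul_eq_mul Complex.I (L _), ← map_smul, ← map_add]
      congr 1
      simp only [Prod.smul_mk, smul_eq_mul, Prod.mk_add_mk, Prod.mk.injEq]
      refine ⟨?_, ?_, ?_⟩ <;> ring_nf <;> simp only [Complex.I_sq] <;> ring
    rw [e1, map_smul, smul_eq_mul]
    ring

/-! ### Combinatorics of the Rankin–Cohen bracket. -/

/-- The coefficients in the transformation formula of the `r`-th derivative of a function which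
transforms like a modular form of weight `K`. -/
def derivCoeff (K : ℂ) : ℕ → ℕ → ℂ
  | 0, 0 => 1
  | 0, _ + 1 => 0
  | r + 1, 0 => derivCoeff K r 0
  | r + 1, i + 1 => (K + 2 * r - i) * derivCoeff K r i + derivCoeff K r (i + 1)

theorem derivCoeff_zero_right (K : ℂ) (r : ℕ) : derivCoeff K r 0 = 1 := by
  induction r with
  | zero => rfl
  | succ r ih => simpa [derivCoeff] using ih

theorem derivCoeff_eq_zero (K : ℂ) (r i : ℕ) (h : r < i) : derivCoeff K r i = 0 := by
  induction r generalizing i with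
  | zero => obtain ⟨i, rfl⟩ := Nat.exists_eq_succ_of_ne_zero h.ne'; rfl
  | succ r ih =>
    obtain ⟨i, rfl⟩ := Nat.exists_eq_succ_of_ne_zero (Nat.ne_zero_of_lt h)
    simp [derivCoeff, ih i (by omega), ih (i + 1) (by omega)]

/-- Both relations reflect the closed form `binom(r,i) (K+r-1)(K+r-2)⋯(K+r-i)`. The first is the one
used later; the second is carried along because the recursion yields the first at the next level
only from the difference of the two. -/
theorem derivCoeff_relations (K : ℂ) (r : ℕ) : ∀ i : ℕ,
    ((i : ℂ) + 1) * derivCoeff K (r + 1) (i + 1) = (r + 1) * (K + r) * derivCoeff K r i ∧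
    ((r : ℂ) + 1 - i) * (K + r - i) * derivCoeff K (r + 1) i =
      (r + 1) * (K + r) * derivCoeff K r i := by
  induction r with
  | zero =>
    intro i
    match i with
    | 0 => simp [derivCoeff]
    | 1 => simp [derivCoeff]
    | i + 2 => simp [derivCoeff]
  | succ r ih =>
    have U : ∀ i : ℕ, ((i : ℂ) + 1) * derivCoeff K (r + 1 + 1) (i + 1) =
        ((r + 1 : ℕ) + 1) * (K + (r + 1 : ℕ)) * derivCoeff K (r + 1) i := by
      intro i
      obtain ⟨h1, h2⟩ := ih i
      rw [derivCoeff]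
      push_cast
      linear_combination h1 - h2
    intro i
    refine ⟨U i, ?_⟩
    match i with
    | 0 => simp [derivCoeff_zero_right]
    | i + 1 =>
      have hi : ((i : ℂ) + 1) ≠ 0 := by exact_mod_cast Nat.succ_ne_zero i
      obtain ⟨h1, h2⟩ := ih i
      have hU := U i
      apply mul_left_cancel₀ hi
      push_cast at hU ⊢
      linear_combination ((r : ℂ) + 1 - i) * (K + r - i) * hU +
        ((r : ℂ) + 1 + 1) * (K + (r + 1)) * (h2 - h1)

open Polynomial in
/-- The polynomial in `e` which describes the transformation of the `r`-th derivative. -/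
def derivPoly (K : ℂ) (F : ℕ → ℂ) (r : ℕ) : ℂ[X] :=
  ∑ i ∈ Finset.range (r + 1), C (derivCoeff K r i * F (r - i)) * X ^ i

theorem derivPoly_eval (K : ℂ) (F : ℕ → ℂ) (r : ℕ) (e : ℂ) :
    (derivPoly K F r).eval e =
      ∑ i ∈ Finset.range (r + 1), derivCoeff K r i * F (r - i) * e ^ i := by
  simp [derivPoly, Polynomial.eval_finsetSum]

theorem derivPoly_eval_zero (K : ℂ) (F : ℕ → ℂ) (r : ℕ) : (derivPoly K F r).eval 0 = F r := by
  rw [derivPoly_eval, Finset.sum_range_succ']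
  simp [derivCoeff_zero_right]

theorem derivative_derivPoly_zero (K : ℂ) (F : ℕ → ℂ) :
    (derivPoly K F 0).derivative = 0 := by
  simp [derivPoly]

theorem derivative_derivPoly_succ (K : ℂ) (F : ℕ → ℂ) (r : ℕ) :
    (derivPoly K F (r + 1)).derivative =
      Polynomial.C (((r : ℂ) + 1) * (K + r)) * derivPoly K F r := by
  rw [derivPoly, Finset.sum_range_succ', derivPoly, Finset.mul_sum, map_add,
    Polynomial.derivative_sum]
  simp only [pow_zero, mul_one, Polynomial.derivative_C, add_zero]
  refine Finset.sum_congr rfl fun i _ => ?_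
  rw [Polynomial.derivative_C_mul_X_pow, ← mul_assoc, ← Polynomial.C_mul, Nat.add_sub_cancel,
    Nat.add_sub_add_right]
  congr 2
  push_cast
  linear_combination F (r - i) * (derivCoeff_relations K r i).1

theorem choose_succ_mul (x : ℝ) (n : ℕ) :
    Ring.choose x (n + 1) * (n + 1) = Ring.choose x n * (x - n) := by
  have h1 : ((n.factorial : ℝ)) ≠ 0 := by positivity
  have e (j : ℕ) : (j.factorial : ℝ) * Ring.choose x j = (descPochhammer ℝ j).eval x := by
    have := Ring.descPochhammer_eq_factorial_smul_choose x j
    rw [nsmul_eq_mul] at this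
    rw [← this, ← Polynomial.aeval_eq_smeval, ← descPochhammer_map (Int.castRingHom ℝ),
      Polynomial.eval_map]
    rfl
  have h2 := e (n + 1)
  rw [descPochhammer_succ_eval, ← e n, Nat.factorial_succ] at h2
  push_cast at h2
  apply mul_left_cancel₀ h1
  linear_combination h2

/-- The coefficients of the Rankin–Cohen bracket in weights `K` and `l`. -/
def bracketCoeff (K l : ℝ) (ν : ℕ) (p : ℕ × ℕ) : ℂ :=
  (-1 : ℂ) ^ p.1 * ((Ring.choose ((ν : ℝ) + K - 1) p.2 : ℝ) : ℂ)
    * ((Ring.choose ((ν : ℝ) + l - 1) p.1 : ℝ) : ℂ)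

/-- This is the cancellation condition for neighbouring terms of the differentiated bracket: the two
products of binomials agree, and `(-1)^r` makes them opposite. -/
theorem bracketCoeff_relation (K l : ℝ) (n : ℕ) (p : ℕ × ℕ)
    (hp : p ∈ Finset.HasAntidiagonal.antidiagonal n) :
    bracketCoeff K l (n + 1) (p.1 + 1, p.2) * ((p.1 + 1) * (K + p.1)) +
      bracketCoeff K l (n + 1) (p.1, p.2 + 1) * ((p.2 + 1) * (l + p.2)) = 0 := by
  obtain ⟨r, s⟩ := p
  rw [Finset.HasAntidiagonal.mem_antidiagonal] at hp
  simp only at hp ⊢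
  subst hp
  have h1 := choose_succ_mul ((r + s + 1 : ℕ) + l - 1) r
  have h2 := choose_succ_mul ((r + s + 1 : ℕ) + K - 1) s
  simp only [bracketCoeff]
  generalize Ring.choose ((r + s + 1 : ℕ) + l - 1) (r + 1) = a at *
  generalize Ring.choose ((r + s + 1 : ℕ) + l - 1) r = a' at *
  generalize Ring.choose ((r + s + 1 : ℕ) + K - 1) (s + 1) = b at *
  generalize Ring.choose ((r + s + 1 : ℕ) + K - 1) s = b' at *
  have h1' : (a : ℂ) * (r + 1) = a' * (l + s) := by
    have : a * (r + 1) = a' * (l + s) := by rw [h1]; push_cast; ring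
    exact_mod_cast this
  have h2' : (b : ℂ) * (s + 1) = b' * (K + r) := by
    have : b * (s + 1) = b' * (K + r) := by rw [h2]; push_cast; ring
    exact_mod_cast this
  linear_combination (-1 : ℂ) ^ (r + 1) * b' * (K + r) * h1' + (-1 : ℂ) ^ r * a' * (l + s) * h2'

theorem sum_bracketCoeff_derivPoly (K l : ℝ) (ν : ℕ) (F G : ℕ → ℂ) (e : ℂ) :
    ∑ p ∈ Finset.HasAntidiagonal.antidiagonal ν, bracketCoeff K l ν p *
        (derivPoly K F p.1).eval e * (derivPoly l G p.2).eval e =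
      ∑ p ∈ Finset.HasAntidiagonal.antidiagonal ν, bracketCoeff K l ν p * F p.1 * G p.2 := by
  let B : Polynomial ℂ := ∑ p ∈ Finset.HasAntidiagonal.antidiagonal ν,
    Polynomial.C (bracketCoeff K l ν p) * (derivPoly K F p.1 * derivPoly l G p.2)
  have hB : B.derivative = 0 := by
    cases ν with
    | zero => simp [B, derivative_derivPoly_zero]
    | succ n =>
      simp only [B, Polynomial.derivative_sum, Polynomial.derivative_C_mul]
      simp only [Polynomial.derivative_mul, mul_add, Finset.sum_add_distrib]
      -- The two halves of the product rule are reindexed over the antidiagonal of `n`; the boundary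
      -- terms vanish because `derivPoly _ _ 0` is constant.
      rw [Finset.Nat.sum_antidiagonal_succ, Finset.Nat.sum_antidiagonal_succ']
      simp only [derivative_derivPoly_zero, derivative_derivPoly_succ, zero_mul, mul_zero,
        zero_add]
      rw [← Finset.sum_add_distrib]
      refine Finset.sum_eq_zero fun p hp => ?_
      have h := congrArg Polynomial.C (bracketCoeff_relation K l n p hp)
      simp only [map_add, map_mul, map_zero] at h ⊢
      linear_combination derivPoly K F p.1 * derivPoly l G p.2 * h
  have hC := Polynomial.eq_C_of_natDegree_eq_zero
    (Polynomial.derivative_eq_zero.mp hB)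
  have h1 : B.eval e = B.eval 0 := by rw [hC]; simp
  simpa [B, Polynomial.eval_finsetSum, derivPoly_eval_zero, mul_assoc] using h1

/-- Passing from the `r`-th to the `(r + 1)`-st derivative in the transformation formula. -/
theorem derivPoly_eval_succ (K : ℂ) (F : ℕ → ℂ) (r : ℕ) (e : ℂ) :
    (derivPoly K F (r + 1)).eval e = (K + 2 * r) * e * (derivPoly K F r).eval e +
      ∑ i ∈ Finset.range (r + 1), derivCoeff K r i *
        (F (r - i + 1) * e ^ i + F (r - i) * (-(i : ℂ) * e ^ (i + 1))) := by
  have h : ∑ i ∈ Finset.range (r + 1), derivCoeff K r i * (F (r - i + 1) * e ^ i) =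
      F (r + 1) + ∑ i ∈ Finset.range (r + 1), derivCoeff K r (i + 1) * F (r - i) * e ^ (i + 1) := by
    rw [Finset.sum_range_succ', Finset.sum_range_succ (n := r),
      derivCoeff_eq_zero K r (r + 1) (by omega), derivCoeff_zero_right]
    simp only [Nat.sub_zero, pow_zero, mul_one, one_mul, zero_mul, add_zero]
    rw [add_comm]
    congr 1
    refine Finset.sum_congr rfl fun i hi => ?_
    rw [Finset.mem_range] at hi
    rw [show r - (i + 1) + 1 = r - i by omega, mul_assoc]
  simp only [mul_add (derivCoeff K r _), Finset.sum_add_distrib]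
  rw [h, derivPoly_eval, derivPoly_eval, Finset.sum_range_succ', derivCoeff_zero_right,
    Finset.mul_sum]
  simp only [Nat.sub_zero, pow_zero, mul_one, one_mul]
  rw [add_comm _ (F (r + 1)), add_left_comm, add_assoc, ← Finset.sum_add_distrib,
    ← Finset.sum_add_distrib]
  congr 1
  refine Finset.sum_congr rfl fun i _ => ?_
  rw [derivCoeff, Nat.add_sub_add_right]
  ring

/-! ### Exponential series in three independent complex variables. -/

/-- The exponents of a series `∑ c exp (2 π i (p u - q v + ρ z))`. -/
structure ExpData (ι : Type*) where
  p : ι → ℝ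
  q : ι → ℝ
  ρ : ι → ℝ
  M : ℝ
  M_nonneg : 0 ≤ M
  p_nonneg : ∀ i, 0 ≤ p i
  q_nonneg : ∀ i, 0 ≤ q i
  ρ_sq_le : ∀ i, ρ i ^ 2 ≤ M * p i

namespace ExpData

variable {ι : Type*} (X : ExpData ι)

/-- The linear form `2 π i (p u - q v + ρ z)`. -/
def form (i : ι) : ℂ × ℂ × ℂ →L[ℂ] ℂ :=
  (2 * Real.pi * Complex.I : ℂ) • ((X.p i : ℂ) • ContinuousLinearMap.fst ℂ ℂ (ℂ × ℂ)
    - (X.q i : ℂ) • (ContinuousLinearMap.fst ℂ ℂ ℂ).comp (ContinuousLinearMap.snd ℂ ℂ (ℂ × ℂ))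
    + (X.ρ i : ℂ) • (ContinuousLinearMap.snd ℂ ℂ ℂ).comp (ContinuousLinearMap.snd ℂ ℂ (ℂ × ℂ)))

theorem form_apply (i : ι) (x : ℂ × ℂ × ℂ) :
    X.form i x = 2 * Real.pi * Complex.I * (X.p i * x.1 - X.q i * x.2.1 + X.ρ i * x.2.2) := rfl

theorem norm_exp_form (i : ι) (x : ℂ × ℂ × ℂ) :
    ‖Complex.exp (X.form i x)‖ =
      Real.exp (-(2 * Real.pi) * (X.p i * x.1.im - X.q i * x.2.1.im + X.ρ i * x.2.2.im)) := by
  rw [Complex.norm_exp, form_apply]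
  congr 1
  simp

/-- The growth condition on the coefficients which makes the series converge for
`Im u > 0`, `Im v < 0`. -/
def Admissible (c : ι → ℂ) : Prop :=
  ∀ y : ℝ, 0 < y → Summable fun i => ‖c i‖ * Real.exp (-y * (X.p i + X.q i))

/-- The sum of the series. -/
def series (c : ι → ℂ) (x : ℂ × ℂ × ℂ) : ℂ := ∑' i, c i * Complex.exp (X.form i x)

theorem norm_form_le (i : ι) :
    ‖X.form i‖ ≤ 2 * Real.pi * ((X.M + 1) * (X.p i + X.q i) + 1) := by
  have hp := X.p_nonneg i
  have hq := X.q_nonneg i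
  have hρ : |X.ρ i| ≤ 1 + X.M * X.p i := by
    have := X.ρ_sq_le i
    rw [← sq_abs] at this
    nlinarith [sq_nonneg (|X.ρ i| - 1), abs_nonneg (X.ρ i)]
  have hM := mul_nonneg X.M_nonneg hq
  refine ContinuousLinearMap.opNorm_le_bound _ (by
    have := mul_nonneg X.M_nonneg hp
    have := Real.pi_pos
    have : 0 ≤ (X.M + 1) * (X.p i + X.q i) + 1 := by nlinarith
    positivity) fun x => ?_
  rw [form_apply, norm_mul]
  have h1 : ‖(2 * Real.pi * Complex.I : ℂ)‖ = 2 * Real.pi := by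
    simp [abs_of_pos Real.pi_pos]
  rw [h1, mul_assoc (2 * Real.pi)]
  refine mul_le_mul_of_nonneg_left ?_ Real.two_pi_pos.le
  have hu : ‖x.1‖ ≤ ‖x‖ := norm_fst_le x
  have hv : ‖x.2.1‖ ≤ ‖x‖ := (norm_fst_le x.2).trans (norm_snd_le x)
  have hz : ‖x.2.2‖ ≤ ‖x‖ := (norm_snd_le x.2).trans (norm_snd_le x)
  calc ‖(X.p i * x.1 - X.q i * x.2.1 + X.ρ i * x.2.2 : ℂ)‖
      ≤ X.p i * ‖x.1‖ + X.q i * ‖x.2.1‖ + |X.ρ i| * ‖x.2.2‖ := by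
        refine (norm_add_le _ _).trans (add_le_add ((norm_sub_le _ _).trans ?_) ?_)
        · simp [abs_of_nonneg hp, abs_of_nonneg hq]
        · simp
    _ ≤ X.p i * ‖x‖ + X.q i * ‖x‖ + |X.ρ i| * ‖x‖ := by gcongr
    _ = (X.p i + X.q i + |X.ρ i|) * ‖x‖ := by ring
    _ ≤ _ := by
      refine mul_le_mul_of_nonneg_right ?_ (norm_nonneg x)
      nlinarith

/-- The growth in `Im z` is linear in `ρ`, and `ρ² ≤ M p`, so completing the square absorbs it into
half of the decay `exp(-2πyp)` at the price of a constant. -/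
theorem exists_norm_exp_form_le {y : ℝ} (R : ℝ) (hy : 0 < y) :
    ∃ C : ℝ, ∀ (i : ι) (x : ℂ × ℂ × ℂ), y ≤ x.1.im → x.2.1.im ≤ -y → |x.2.2.im| ≤ R →
      ‖Complex.exp (X.form i x)‖ ≤ C * Real.exp (-(Real.pi * y) * (X.p i + X.q i)) := by
  have hpi := Real.pi_pos
  have hM := X.M_nonneg
  let ε : ℝ := y / (2 * (X.M + 1))
  have hε : 0 < ε := by positivity
  have hεM : ε * X.M ≤ y / 2 := by
    have : ε * (X.M + 1) = y / 2 := by simp only [ε]; field_simp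
    nlinarith
  refine ⟨Real.exp (2 * Real.pi * (R ^ 2 / (4 * ε))), fun i x hu hv hz => ?_⟩
  rw [norm_exp_form, ← Real.exp_add, Real.exp_le_exp]
  have hp := X.p_nonneg i
  have hq := X.q_nonneg i
  have h1 : -(X.ρ i * x.2.2.im) ≤ |X.ρ i| * R := by
    refine (neg_le_abs _).trans ?_
    rw [abs_mul]
    gcongr
  have h2 : |X.ρ i| * R ≤ ε * X.ρ i ^ 2 + R ^ 2 / (4 * ε) := by
    rw [← sq_abs (X.ρ i)]
    have : ε * |X.ρ i| ^ 2 + R ^ 2 / (4 * ε) - |X.ρ i| * R =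
        ε * (|X.ρ i| - R / (2 * ε)) ^ 2 := by
      field_simp
      ring
    nlinarith [mul_nonneg hε.le (sq_nonneg (|X.ρ i| - R / (2 * ε)))]
  have h3 : ε * X.ρ i ^ 2 ≤ y / 2 * X.p i := by
    calc ε * X.ρ i ^ 2 ≤ ε * (X.M * X.p i) := by gcongr; exact X.ρ_sq_le i
      _ = ε * X.M * X.p i := by ring
      _ ≤ _ := by gcongr
  have h4 : X.p i * y ≤ X.p i * x.1.im := by gcongr
  have h5 : X.q i * y ≤ X.q i * -x.2.1.im := by
    refine mul_le_mul_of_nonneg_left ?_ hq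
    linarith
  have h6 : -(X.p i * x.1.im - X.q i * x.2.1.im + X.ρ i * x.2.2.im) ≤
      -(y / 2 * (X.p i + X.q i)) + R ^ 2 / (4 * ε) := by
    have := mul_nonneg hq hy.le
    linarith
  have := mul_le_mul_of_nonneg_left h6 Real.two_pi_pos.le
  linarith

/-- Factors from differentiation cost only an arbitrarily small part of the exponential decay. -/
theorem exists_affine_le_exp {a b y : ℝ} (ha : 0 ≤ a) (hb : 0 ≤ b) (hy : 0 < y) :
    ∃ C : ℝ, 0 ≤ C ∧ ∀ t : ℝ, 0 ≤ t → a * t + b ≤ C * Real.exp (y * t) := by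
  refine ⟨a / y + b, by positivity, fun t ht => ?_⟩
  have h1 := Real.add_one_le_exp (y * t)
  have h2 : 1 ≤ Real.exp (y * t) := Real.one_le_exp (by positivity)
  have h3 : a * t = a / y * (y * t) := by field_simp
  have h4 : a / y * (y * t) ≤ a / y * Real.exp (y * t) := by
    gcongr
    linarith
  nlinarith

theorem Admissible.mul_q {c : ι → ℂ} (hc : X.Admissible c) :
    X.Admissible fun i => c i * X.q i := by
  intro y hy
  obtain ⟨C, hC, h⟩ := exists_affine_le_exp zero_le_one le_rfl (half_pos hy)
  refine ((hc _ (half_pos hy)).mul_left C).of_nonneg_of_le (fun i => by positivity) fun i => ?_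
  have hp := X.p_nonneg i
  have hq := X.q_nonneg i
  have h1 := h (X.p i + X.q i) (by positivity)
  rw [norm_mul, Complex.norm_real, Real.norm_of_nonneg hq]
  have h2 : Real.exp (-(y / 2) * (X.p i + X.q i)) =
      Real.exp (y / 2 * (X.p i + X.q i)) * Real.exp (-y * (X.p i + X.q i)) := by
    rw [← Real.exp_add]; congr 1; ring
  rw [h2]
  calc ‖c i‖ * X.q i * Real.exp (-y * (X.p i + X.q i))
      ≤ ‖c i‖ * (C * Real.exp (y / 2 * (X.p i + X.q i))) *
          Real.exp (-y * (X.p i + X.q i)) := by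
        gcongr
        linarith
    _ = _ := by ring

theorem Admissible.mul_q_pow {c : ι → ℂ} (hc : X.Admissible c) (j : ℕ) :
    X.Admissible fun i => c i * (X.q i : ℂ) ^ j := by
  induction j with
  | zero => simpa using hc
  | succ j ih => simpa [pow_succ, mul_assoc] using ih.mul_q

theorem Admissible.summable {c : ι → ℂ} (hc : X.Admissible c) {x : ℂ × ℂ × ℂ}
    (hu : 0 < x.1.im) (hv : x.2.1.im < 0) :
    Summable fun i => ‖c i * Complex.exp (X.form i x)‖ := by
  have hy : 0 < min x.1.im (-x.2.1.im) := lt_min hu (by linarith)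
  obtain ⟨C, h⟩ := X.exists_norm_exp_form_le |x.2.2.im| hy
  refine ((hc _ (mul_pos Real.pi_pos hy)).mul_left C).of_nonneg_of_le
    (fun i => norm_nonneg _) fun i => ?_
  have := h i x (min_le_left _ _)
    (by linarith [min_le_right x.1.im (-x.2.1.im)]) le_rfl
  rw [norm_mul]
  exact (mul_le_mul_of_nonneg_left this (norm_nonneg _)).trans_eq (by ring)

theorem Admissible.hasFDerivAt {c : ι → ℂ} (hc : X.Admissible c) {x : ℂ × ℂ × ℂ}
    (hu : 0 < x.1.im) (hv : x.2.1.im < 0) :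
    ∃ L : ℂ × ℂ × ℂ →L[ℂ] ℂ, HasFDerivAt (X.series c) L x ∧
      L (0, 1, 0) = -(2 * Real.pi * Complex.I) * X.series (fun i => c i * X.q i) x := by
  -- Half the distance to the boundary, so on the ball of radius `y` the imaginary parts keep
  -- distance `y` from zero.
  let y := min x.1.im (-x.2.1.im) / 2
  have hy : 0 < y := half_pos (lt_min hu (by linarith))
  have hyu : y + y ≤ x.1.im := by simp only [y, add_halves]; exact min_le_left _ _
  have hyv : x.2.1.im ≤ -(y + y) := by
    simp only [y, add_halves]; linarith [min_le_right x.1.im (-x.2.1.im)]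
  obtain ⟨C, h⟩ := X.exists_norm_exp_form_le (|x.2.2.im| + y) hy
  have hpy : 0 < Real.pi * y := mul_pos Real.pi_pos hy
  obtain ⟨C', hC', h'⟩ := exists_affine_le_exp (a := 2 * Real.pi * (X.M + 1)) (b := 2 * Real.pi)
    (y := Real.pi * y / 2)
    (by have := X.M_nonneg; have := Real.pi_pos; positivity) Real.two_pi_pos.le (half_pos hpy)
  let f' : ι → ℂ × ℂ × ℂ → (ℂ × ℂ × ℂ →L[ℂ] ℂ) :=
    fun i w => c i • Complex.exp (X.form i w) • X.form i
  have hf : ∀ i w, w ∈ Metric.ball x y →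
      HasFDerivAt (fun w => c i * Complex.exp (X.form i w)) (f' i w) w := fun i w _ =>
    ((X.form i).hasFDerivAt.cexp).const_mul (c i)
  have hu' := (hc _ (half_pos hpy)).mul_left (C * C')
  have hC0 : ∀ i, 0 ≤ C * Real.exp (-(Real.pi * y) * (X.p i + X.q i)) := fun i =>
    (norm_nonneg _).trans (h i x (by linarith) (by linarith) (by linarith))
  have hf' : ∀ i w, w ∈ Metric.ball x y → ‖f' i w‖ ≤
      C * C' * (‖c i‖ * Real.exp (-(Real.pi * y / 2) * (X.p i + X.q i))) := by
    intro i w hw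
    rw [Metric.mem_ball, dist_eq_norm] at hw
    have hp := X.p_nonneg i
    have hq := X.q_nonneg i
    have h1 : |w.1.im - x.1.im| ≤ y := by
      rw [← Complex.sub_im]
      exact (Complex.abs_im_le_norm _).trans ((norm_fst_le (w - x)).trans hw.le)
    have h2 : |w.2.1.im - x.2.1.im| ≤ y := by
      rw [← Complex.sub_im]
      exact (Complex.abs_im_le_norm _).trans
        (((norm_fst_le (w - x).2).trans (norm_snd_le (w - x))).trans hw.le)
    have h3 : |w.2.2.im - x.2.2.im| ≤ y := by
      rw [← Complex.sub_im]
      exact (Complex.abs_im_le_norm _).trans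
        (((norm_snd_le (w - x).2).trans (norm_snd_le (w - x))).trans hw.le)
    have h4 := h i w (by linarith [(abs_le.mp h1).1]) (by linarith [(abs_le.mp h2).2])
      (by linarith [abs_sub_abs_le_abs_sub w.2.2.im x.2.2.im])
    have h5 : ‖X.form i‖ ≤ C' * Real.exp (Real.pi * y / 2 * (X.p i + X.q i)) := by
      refine (X.norm_form_le i).trans (le_trans (le_of_eq ?_) (h' (X.p i + X.q i) (by positivity)))
      ring
    have h6 : Real.exp (-(Real.pi * y / 2) * (X.p i + X.q i)) =
        Real.exp (-(Real.pi * y) * (X.p i + X.q i)) *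
          Real.exp (Real.pi * y / 2 * (X.p i + X.q i)) := by
      rw [← Real.exp_add]; congr 1; ring
    simp only [f', norm_smul]
    rw [h6]
    calc ‖c i‖ * (‖Complex.exp (X.form i w)‖ * ‖X.form i‖)
        ≤ ‖c i‖ * ((C * Real.exp (-(Real.pi * y) * (X.p i + X.q i))) *
            (C' * Real.exp (Real.pi * y / 2 * (X.p i + X.q i)))) := by
          have := hC0 i
          gcongr
      _ = _ := by ring
  have hx : x ∈ Metric.ball x y := Metric.mem_ball_self hy
  refine ⟨∑' i, f' i x, hasFDerivAt_tsum_of_isPreconnected hu' Metric.isOpen_ball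
    (convex_ball x y).isPreconnected hf hf' hx (hc.summable X hu hv).of_norm hx, ?_⟩
  have hs : Summable fun i => f' i x := Summable.of_norm_bounded hu' fun i => hf' i x hx
  rw [← ContinuousLinearMap.apply_apply (𝕜 := ℂ) (0, 1, 0) (∑' i, f' i x),
    ContinuousLinearMap.map_tsum _ hs, series, ← tsum_mul_left]
  refine tsum_congr fun i => ?_
  simp only [ContinuousLinearMap.apply_apply, f', smul_apply, smul_eq_mul, form_apply]
  ring

theorem Admissible.hasAntiD {c : ι → ℂ} (hc : X.Admissible c) {A B C : ℂ → ℂ} {A' B' C' : ℂ}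
    {τ : ℍ} (hu : 0 < (A τ).im) (hv : 0 < (B τ).im)
    (hA : HasDerivAt A A' τ) (hB : HasDerivAt B B' τ) (hC : HasDerivAt C C' τ) :
    HasAntiD (fun τ => X.series c (A τ, conj (B τ), C τ))
      (conj B' * X.series (fun i => c i * X.q i) (A τ, conj (B τ), C τ)) τ := by
  obtain ⟨L, hL, hL'⟩ := hc.hasFDerivAt X (x := (A τ, conj (B τ), C τ)) hu (by simpa using hv)
  refine (hasAntiD_comp₃ hL hA hB hC).congr_deriv ?_
  rw [hL']
  have : (2 * Real.pi * Complex.I : ℂ) ≠ 0 := Complex.two_pi_I_ne_zero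
  field_simp

theorem Admissible.differentiable_right {c : ι → ℂ} (hc : X.Admissible c) {u v : ℂ}
    (hu : 0 < u.im) (hv : v.im < 0) : Differentiable ℂ fun z => X.series c (u, v, z) := by
  intro z
  obtain ⟨L, hL, -⟩ := hc.hasFDerivAt X (x := (u, v, z)) hu hv
  exact hL.differentiableAt.comp z (f := fun z => (u, v, z)) (by fun_prop)

theorem Admissible.hasSum {c : ι → ℂ} (hc : X.Admissible c) {x : ℂ × ℂ × ℂ}
    (hu : 0 < x.1.im) (hv : x.2.1.im < 0) :
    HasSum (fun i => c i * Complex.exp (X.form i x)) (X.series c x) :=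
  (hc.summable X hu hv).of_norm.hasSum

/-- At `τ = iy/(2π)`, `z = 0` the norm of the `i`-th term is exactly `‖c i‖ exp(-y(p i + q i))`. -/
theorem admissible_of_summable {c : ι → ℂ}
    (h : ∀ τ : ℍ, Summable fun i => c i * Complex.exp (X.form i (τ, conj (τ : ℂ), 0))) :
    X.Admissible c := by
  intro y hy
  have h2 := (h ⟨(y / (2 * Real.pi) : ℝ) * Complex.I, by
    have := Real.pi_pos
    simp only [Complex.im_ofReal_mul, Complex.I_im, mul_one]
    positivity⟩).norm
  refine h2.congr fun i => ?_
  rw [norm_mul, norm_exp_form]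
  congr 2
  simp only [Complex.conj_im, Complex.im_ofReal_mul, Complex.I_im,
    Complex.zero_im]
  have := Real.pi_pos
  field_simp
  ring

end ExpData

/-! ### Automorphy factors and the transformation of derivatives. -/

theorem coe_smul_eq_div_autFactor (γ : SL(2, ℤ)) (τ : ℍ) :
    ((γ • τ : ℍ) : ℂ) = (((γ 0 0 : ℤ) : ℂ) * τ + ((γ 0 1 : ℤ) : ℂ)) / autFactor γ τ := by
  rw [coe_specialLinearGroup_apply]
  simp [autFactor]

theorem autFactor_ne_zero (γ : SL(2, ℤ)) (τ : ℍ) : autFactor γ τ ≠ 0 :=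
  denom_ne_zero (γ : GL (Fin 2) ℝ) τ

theorem hasDerivAt_autFactor (γ : SL(2, ℤ)) (w : ℂ) :
    HasDerivAt (fun w : ℂ => ((γ 1 0 : ℤ) : ℂ) * w + ((γ 1 1 : ℤ) : ℂ)) ((γ 1 0 : ℤ) : ℂ) w := by
  simpa using ((hasDerivAt_id w).const_mul ((γ 1 0 : ℤ) : ℂ)).add_const ((γ 1 1 : ℤ) : ℂ)

theorem hasDerivAt_moebius (γ : SL(2, ℤ)) (τ : ℍ) :
    HasDerivAt (fun w : ℂ => (((γ 0 0 : ℤ) : ℂ) * w + ((γ 0 1 : ℤ) : ℂ)) /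
      (((γ 1 0 : ℤ) : ℂ) * w + ((γ 1 1 : ℤ) : ℂ))) (autFactor γ τ ^ 2)⁻¹ τ := by
  have h := (((hasDerivAt_id (τ : ℂ)).const_mul ((γ 0 0 : ℤ) : ℂ)).add_const
    ((γ 0 1 : ℤ) : ℂ)).div (hasDerivAt_autFactor γ τ) (autFactor_ne_zero γ τ)
  refine h.congr_deriv ?_
  have hdet : ((γ 0 0 : ℤ) : ℂ) * ((γ 1 1 : ℤ) : ℂ) - ((γ 0 1 : ℤ) : ℂ) * ((γ 1 0 : ℤ) : ℂ) = 1 := by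
    have := γ.det_coe
    rw [Matrix.det_fin_two] at this
    exact_mod_cast this
  rw [← autFactor, ← one_div]
  congr 1
  simp only [autFactor, id]
  linear_combination hdet

theorem hasDerivAt_autFactor_cpow (γ : SL(2, ℤ)) (a : ℂ) (τ : ℍ) :
    HasDerivAt (fun w : ℂ => (((γ 1 0 : ℤ) : ℂ) * w + ((γ 1 1 : ℤ) : ℂ)) ^ a)
      (a * ((γ 1 0 : ℤ) : ℂ) * autFactor γ τ ^ a / autFactor γ τ) τ := by
  -- For `c = 0` the function is constant, though `d` may lie on the branch cut; for `c ≠ 0` the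
  -- value `cτ+d` is not real.
  by_cases hc : γ 1 0 = 0
  · simp only [hc, Int.cast_zero, zero_mul, zero_add, mul_zero, zero_div]
    exact hasDerivAt_const _ _
  · have hs : autFactor γ τ ∈ Complex.slitPlane := by
      right
      simp only [autFactor, Complex.add_im, Complex.mul_im, Complex.intCast_re,
        Complex.intCast_im, coe_im, zero_mul, add_zero]
      exact mul_ne_zero (by exact_mod_cast hc) τ.im_ne_zero
    refine ((hasDerivAt_autFactor γ τ).cpow_const (c := a) hs).congr_deriv ?_
    rw [← autFactor, Complex.cpow_sub _ _ (autFactor_ne_zero γ τ), Complex.cpow_one]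
    ring

/-- The function `-c / (2 π i (c τ̄ + d))`, the logarithmic derivative of `c τ̄ + d` with respect
to `D_{-τ̄}`. -/
def antiShift (γ : SL(2, ℤ)) (τ : ℍ) : ℂ :=
  conj (((γ 1 0 : ℤ) : ℂ) / (2 * Real.pi * Complex.I * autFactor γ τ))

theorem hasAntiD_conj_autFactor_cpow (γ : SL(2, ℤ)) (a : ℝ) (τ : ℍ) :
    HasAntiD (fun τ => conj (autFactor γ τ ^ (a : ℂ)))
      (a * antiShift γ τ * conj (autFactor γ τ ^ (a : ℂ))) τ := by
  refine (hasAntiD_conj_of_hasDerivAt (hasDerivAt_autFactor_cpow γ a τ)).congr_deriv ?_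
  have h1 := autFactor_ne_zero γ τ
  have h2 : conj (autFactor γ τ) ≠ 0 := by simpa using h1
  have h3 : (Real.pi : ℂ) ≠ 0 := by exact_mod_cast Real.pi_ne_zero
  simp only [antiShift, map_div₀, map_mul, Complex.conj_ofReal, map_intCast, Complex.conj_I,
    map_ofNat]
  field_simp

theorem hasAntiD_antiShift (γ : SL(2, ℤ)) (τ : ℍ) :
    HasAntiD (antiShift γ) (-antiShift γ τ ^ 2) τ := by
  have h1 := autFactor_ne_zero γ τ
  have h := ((hasDerivAt_autFactor γ τ).const_mul (2 * Real.pi * Complex.I : ℂ)).fun_inv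
    (mul_ne_zero Complex.two_pi_I_ne_zero h1)
  refine (hasAntiD_conj_of_hasDerivAt (h.const_mul ((γ 1 0 : ℤ) : ℂ))).congr_deriv ?_
  rw [← autFactor]
  have h2 : conj (autFactor γ τ) ≠ 0 := by simpa using h1
  have h3 : (Real.pi : ℂ) ≠ 0 := by exact_mod_cast Real.pi_ne_zero
  simp only [antiShift, map_div₀, map_mul, Complex.conj_ofReal, map_intCast, Complex.conj_I,
    map_ofNat, map_neg, map_pow]
  field_simp

theorem hasAntiD_antiShift_pow (γ : SL(2, ℤ)) (i : ℕ) (τ : ℍ) :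
    HasAntiD (fun τ => antiShift γ τ ^ i) (-(i : ℂ) * antiShift γ τ ^ (i + 1)) τ := by
  induction i with
  | zero => simpa using hasAntiD_const 1 τ
  | succ i ih =>
    simp only [pow_succ _ i]
    refine (ih.mul (hasAntiD_antiShift γ τ)).congr_deriv ?_
    push_cast
    ring

/-- The transformation formula for the derivatives of a function of weight `K`. -/
theorem deriv_transformation {γ : SL(2, ℤ)} {K : ℝ} {F G : ℕ → ℍ → ℂ} {H : ℂ → ℂ}
    (hH : ∀ τ : ℍ, DifferentiableAt ℂ H τ)
    (hF : ∀ r τ, HasAntiD (F r) (F (r + 1) τ) τ)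
    (hG : ∀ r τ, HasAntiD (G r) (conj (autFactor γ τ ^ 2)⁻¹ * G (r + 1) τ) τ)
    (h0 : ∀ τ : ℍ, G 0 τ = H τ * conj (autFactor γ τ ^ (K : ℂ)) * F 0 τ) (r : ℕ) (τ : ℍ) :
    G r τ = H τ * conj (autFactor γ τ ^ (K : ℂ)) * conj (autFactor γ τ) ^ (2 * r) *
      (derivPoly K (fun i => F i τ) r).eval (antiShift γ τ) := by
  have key (r : ℕ) (τ : ℍ) : conj (autFactor γ τ ^ ((K + 2 * r : ℝ) : ℂ)) =
      conj (autFactor γ τ ^ (K : ℂ)) * conj (autFactor γ τ) ^ (2 * r) := by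
    rw [← map_pow, ← map_mul, ← Complex.cpow_natCast,
      ← Complex.cpow_add _ _ (autFactor_ne_zero γ τ)]
    push_cast
    rfl
  induction r generalizing τ with
  | zero => rw [h0]; simp [derivPoly, derivCoeff]
  | succ r ih =>
    have h1 : G r = fun τ : ℍ => H τ * conj (autFactor γ τ ^ ((K + 2 * r : ℝ) : ℂ)) *
        ∑ i ∈ Finset.range (r + 1), derivCoeff K r i * (F (r - i) τ * antiShift γ τ ^ i) := by
      ext τ
      rw [ih, key, derivPoly_eval]
      simp only [mul_assoc]
    have h2 := ((hasAntiD_of_hasDerivAt (hH τ).hasDerivAt).mul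
      (hasAntiD_conj_autFactor_cpow γ (K + 2 * r) τ)).mul
      (HasAntiD.sum (s := Finset.range (r + 1)) fun i _ =>
        (hasAntiD_const (derivCoeff K r i) τ).mul
          ((hF (r - i) τ).mul (hasAntiD_antiShift_pow γ i τ)))
    have h3 := hG r τ
    rw [h1] at h3
    -- The chain rule (`h3`) and the product rule applied to the inductive formula (`h2`) compute
    -- the same derivative.
    have h4 := h3.unique h2
    have h5 : conj (autFactor γ τ) ≠ 0 := by simpa using autFactor_ne_zero γ τ
    simp only [zero_mul, zero_add] at h4
    rw [derivPoly_eval_succ, derivPoly_eval, show 2 * (r + 1) = 2 * r + 2 by ring, pow_add]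
    simp only [← mul_assoc] at h4
    rw [key] at h4
    rw [map_inv₀, map_pow, inv_mul_eq_iff_eq_mul₀ (pow_ne_zero 2 h5)] at h4
    rw [h4]
    push_cast
    simp only [mul_assoc]
    ring

theorem bracket_transformation {K l : ℝ} {F G F₂ G₂ : ℕ → ℂ} {H H₂ j e : ℂ}
    (h₁ : ∀ r, G r = H * j ^ (2 * r) * (derivPoly K F r).eval e)
    (h₂ : ∀ r, G₂ r = H₂ * j ^ (2 * r) * (derivPoly l F₂ r).eval e) (ν : ℕ) :
    ∑ p ∈ Finset.HasAntidiagonal.antidiagonal ν, bracketCoeff K l ν p * G p.1 * G₂ p.2 =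
      H * H₂ * j ^ (2 * ν) *
      ∑ p ∈ Finset.HasAntidiagonal.antidiagonal ν, bracketCoeff K l ν p * F p.1 * F₂ p.2 := by
  rw [← sum_bracketCoeff_derivPoly K l ν F F₂ e, Finset.mul_sum]
  refine Finset.sum_congr rfl fun p hp => ?_
  rw [Finset.HasAntidiagonal.mem_antidiagonal] at hp
  rw [h₁, h₂, ← hp, show 2 * (p.1 + p.2) = 2 * p.1 + 2 * p.2 by ring, pow_add]
  ring

theorem iterate_antiD {F : ℕ → ℍ → ℂ} (hF : ∀ r τ, HasAntiD (F r) (F (r + 1) τ) τ) (r : ℕ) :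
    antiD^[r] (F 0) = F r := by
  induction r with
  | zero => rfl
  | succ r ih =>
    rw [Function.iterate_succ_apply', ih]
    ext τ
    exact (hF r τ).antiD_eq

namespace ExpData

variable {ι : Type*} (X : ExpData ι)

theorem Admissible.hasAntiD_diagonal {c : ι → ℂ} (hc : X.Admissible c) (z : ℂ) (r : ℕ) (τ : ℍ) :
    HasAntiD (fun τ : ℍ => X.series (fun i => c i * (X.q i : ℂ) ^ r) (τ, conj (τ : ℂ), z))
      (X.series (fun i => c i * (X.q i : ℂ) ^ (r + 1)) (τ, conj (τ : ℂ), z)) τ := by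
  have h := (hc.mul_q_pow X r).hasAntiD X (τ := τ) τ.im_pos τ.im_pos (hasDerivAt_id (τ : ℂ))
    (hasDerivAt_id (τ : ℂ)) (hasDerivAt_const (τ : ℂ) z)
  refine h.congr_deriv ?_
  simp only [map_one, one_mul, id, pow_succ, mul_assoc]

/-- The first and third arguments are holomorphic in `τ`; only the conjugated Möbius image
contributes, through its derivative `(cτ+d)^(-2)`. -/
theorem Admissible.hasAntiD_smul {c : ι → ℂ} (hc : X.Admissible c) (γ : SL(2, ℤ))
    (lam : ℤ) (z : ℂ) (r : ℕ) (τ : ℍ) :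
    HasAntiD (fun τ : ℍ => X.series (fun i => c i * (X.q i : ℂ) ^ r)
        ((γ • τ : ℍ), conj ((γ • τ : ℍ) : ℂ), (z + lam * (τ : ℂ)) / autFactor γ τ))
      (conj (autFactor γ τ ^ 2)⁻¹ * X.series (fun i => c i * (X.q i : ℂ) ^ (r + 1))
        ((γ • τ : ℍ), conj ((γ • τ : ℍ) : ℂ), (z + lam * (τ : ℂ)) / autFactor γ τ)) τ := by
  have hm := hasDerivAt_moebius γ τ
  have hw : HasDerivAt (fun w : ℂ => (z + lam * w) /
      (((γ 1 0 : ℤ) : ℂ) * w + ((γ 1 1 : ℤ) : ℂ))) _ (τ : ℂ) :=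
    (((hasDerivAt_id (τ : ℂ)).const_mul (lam : ℂ)).const_add z).div
      (hasDerivAt_autFactor γ τ) (autFactor_ne_zero γ τ)
  have him : 0 < ((((γ 0 0 : ℤ) : ℂ) * (τ : ℂ) + ((γ 0 1 : ℤ) : ℂ)) /
      (((γ 1 0 : ℤ) : ℂ) * (τ : ℂ) + ((γ 1 1 : ℤ) : ℂ))).im := by
    rw [← autFactor, ← coe_smul_eq_div_autFactor]
    exact (γ • τ).im_pos
  have h := (hc.mul_q_pow X r).hasAntiD X him him hm hm hw
  have hj : ∀ τ : ℍ, ((γ 1 0 : ℤ) : ℂ) * (τ : ℂ) + ((γ 1 1 : ℤ) : ℂ) = autFactor γ τ :=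
    fun _ => rfl
  simp only [hj, ← coe_smul_eq_div_autFactor] at h
  refine h.congr_deriv ?_
  simp only [pow_succ _ r, mul_assoc]

end ExpData

/-! ### Fourier expansions and the cusp condition. -/

/-- The exponents of the expansion of a skew-holomorphic Jacobi form of index `m`. -/
def jacobiData (m : ℕ) (hm : 0 < m) (κ : ℝ) : ExpData (ℤ × ℤ) where
  p i := (i.2 : ℝ) ^ 2 / (4 * m)
  -- The truncation at `0` makes `q` nonnegative on all of `ℤ × ℤ`; it changes `q` only where the
  -- coefficient `d` vanishes.
  q i := max ((i.2 : ℝ) ^ 2 - 4 * m * (i.1 + κ)) 0 / (4 * m)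
  ρ i := i.2
  M := 4 * m
  M_nonneg := by positivity
  p_nonneg _ := by positivity
  q_nonneg _ := by positivity
  ρ_sq_le i := by
    have : (m : ℝ) ≠ 0 := by exact_mod_cast hm.ne'
    exact le_of_eq (by field_simp)

/-- The exponents of the expansion of the complex conjugate of a modular form. -/
def conjData (κ : ℝ) (hκ : 0 ≤ κ) : ExpData ℕ where
  p _ := 0
  q n := n + κ
  ρ _ := 0
  M := 0
  M_nonneg := le_rfl
  p_nonneg _ := le_rfl
  q_nonneg _ := by positivity
  ρ_sq_le _ := by simp

/-- Substituting `τ̄ = τ - 2iy` turns the real exponential in `y` into a linear form in `τ` and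
`τ̄`. -/
theorem skew_term_eq (m : ℕ) (hm : 0 < m) (x r : ℝ) (τ : ℍ) (z : ℂ) :
    Complex.exp ((-(Real.pi * τ.im / m) * (r ^ 2 - 4 * m * x) : ℝ) : ℂ)
      * Complex.exp (2 * Real.pi * Complex.I * x * τ)
      * Complex.exp (2 * Real.pi * Complex.I * r * z) =
    Complex.exp (2 * Real.pi * Complex.I * (((r ^ 2 / (4 * m) : ℝ) : ℂ) * τ
      - (((r ^ 2 - 4 * m * x) / (4 * m) : ℝ) : ℂ) * conj (τ : ℂ) + r * z)) := by
  rw [← Complex.exp_add, ← Complex.exp_add]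
  congr 1
  have hτ : conj (τ : ℂ) = τ - 2 * τ.im * Complex.I := by
    apply Complex.ext
    · simp
    · simp; ring
  have hm' : (m : ℂ) ≠ 0 := by exact_mod_cast hm.ne'
  rw [hτ]
  push_cast
  field_simp
  ring_nf
  simp only [Complex.I_sq]
  ring

theorem jacobiData_term_eq {m : ℕ} (hm : 0 < m) {κ : ℝ} {d : ℤ → ℤ → ℂ}
    (hd : ∀ n r : ℤ, (r : ℝ) ^ 2 - 4 * m * (n + κ) < 0 → d n r = 0) (i : ℤ × ℤ) (τ : ℍ) (z : ℂ) :
    d i.1 i.2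
      * Complex.exp (((-(Real.pi * τ.im / m) * ((i.2 : ℝ) ^ 2 - 4 * m * (i.1 + κ)) : ℝ)) : ℂ)
      * Complex.exp (2 * Real.pi * Complex.I * ((i.1 : ℂ) + κ) * τ)
      * Complex.exp (2 * Real.pi * Complex.I * i.2 * z) =
    d i.1 i.2 * Complex.exp ((jacobiData m hm κ).form i (τ, conj (τ : ℂ), z)) := by
  rcases lt_or_ge ((i.2 : ℝ) ^ 2 - 4 * m * (i.1 + κ)) 0 with h | h
  · simp [hd _ _ h]
  · have := skew_term_eq m hm (i.1 + κ) i.2 τ z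
    rw [ExpData.form_apply]
    simp only [jacobiData, max_eq_left h, mul_assoc (d i.1 i.2)]
    congr 1
    push_cast at this ⊢
    exact this

theorem conjData_term_eq {κ : ℝ} (hκ : 0 ≤ κ) (a : ℕ → ℂ) (n : ℕ) (τ : ℍ) :
    conj (a n * Complex.exp (2 * Real.pi * Complex.I * ((n : ℂ) + κ) * τ)) =
      conj (a n) * Complex.exp ((conjData κ hκ).form n (τ, conj (τ : ℂ), 0)) := by
  rw [map_mul, ← Complex.exp_conj, ExpData.form_apply]
  congr 2
  simp only [map_mul, map_add, Complex.conj_ofReal, Complex.conj_I, map_natCast, map_ofNat,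
    conjData]
  push_cast
  ring

theorem HasSkewExpansion.series {m : ℕ} (hm : 0 < m) {κ : ℝ} {d : ℤ → ℤ → ℂ} {f : ℍ → ℂ → ℂ}
    (h : HasSkewExpansion m κ d f) :
    (jacobiData m hm κ).Admissible (fun i => d i.1 i.2) ∧
    ∀ τ z, f τ z = (jacobiData m hm κ).series (fun i => d i.1 i.2) (τ, conj (τ : ℂ), z) := by
  have h2 := h.2
  simp only [jacobiData_term_eq hm h.1] at h2
  exact ⟨ExpData.admissible_of_summable _ fun τ => (h2 τ 0).summable,
    fun τ z => (h2 τ z).tsum_eq.symm⟩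

theorem conj_eq_series {κ : ℝ} (hκ : 0 ≤ κ) {a : ℕ → ℂ} {g : ℍ → ℂ}
    (h : ∀ τ : ℍ, HasSum
      (fun n : ℕ => a n * Complex.exp (2 * Real.pi * Complex.I * ((n : ℂ) + κ) * τ)) (g τ)) :
    (conjData κ hκ).Admissible (fun n => conj (a n)) ∧
    ∀ τ, conj (g τ) = (conjData κ hκ).series (fun n => conj (a n)) (τ, conj (τ : ℂ), 0) := by
  have h2 : ∀ τ : ℍ, HasSum (fun n : ℕ => conj (a n) *
      Complex.exp ((conjData κ hκ).form n (τ, conj (τ : ℂ), 0))) (conj (g τ)) := fun τ => by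
    simpa only [conjData_term_eq hκ] using Complex.hasSum_conj'.mpr (h τ)
  exact ⟨ExpData.admissible_of_summable _ fun τ => (h2 τ).summable,
    fun τ => (h2 τ).tsum_eq.symm⟩

/-- The translation `((n, r), N) ↦ ((n + N - t, r), N)`. -/
def shiftEquiv (t : ℤ) : (ℤ × ℤ) × ℕ ≃ (ℤ × ℤ) × ℕ where
  toFun j := ((j.1.1 + j.2 - t, j.1.2), j.2)
  invFun j := ((j.1.1 - j.2 + t, j.1.2), j.2)
  left_inv j := by ext <;> simp; ring
  right_inv j := by ext <;> simp; ring

/-- The product expansion of a bilinear combination of derivatives of two series. -/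
theorem hasSum_bilinear {ι κ : Type*} (X : ExpData ι) (Y : ExpData κ) {c : ι → ℂ} {a : κ → ℂ}
    (hX : X.Admissible c) (hY : Y.Admissible a) (s : Finset (ℕ × ℕ)) (β : ℕ × ℕ → ℂ)
    {x y : ℂ × ℂ × ℂ} (hxu : 0 < x.1.im) (hxv : x.2.1.im < 0) (hyu : 0 < y.1.im)
    (hyv : y.2.1.im < 0) :
    HasSum (fun j : ι × κ =>
        (∑ p ∈ s, β p * (c j.1 * (X.q j.1 : ℂ) ^ p.1) * (a j.2 * (Y.q j.2 : ℂ) ^ p.2)) *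
        (Complex.exp (X.form j.1 x) * Complex.exp (Y.form j.2 y)))
      (∑ p ∈ s, β p * X.series (fun i => c i * (X.q i : ℂ) ^ p.1) x *
        Y.series (fun n => a n * (Y.q n : ℂ) ^ p.2) y) := by
  have h (p : ℕ × ℕ) : HasSum (fun j : ι × κ =>
      β p * ((c j.1 * (X.q j.1 : ℂ) ^ p.1 * Complex.exp (X.form j.1 x)) *
        (a j.2 * (Y.q j.2 : ℂ) ^ p.2 * Complex.exp (Y.form j.2 y))))
      (β p * (X.series (fun i => c i * (X.q i : ℂ) ^ p.1) x *
        Y.series (fun n => a n * (Y.q n : ℂ) ^ p.2) y)) := by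
    have hX' := hX.mul_q_pow X p.1
    have hY' := hY.mul_q_pow Y p.2
    have h1 := hX'.hasSum X hxu hxv
    have h2 := hY'.hasSum Y hyu hyv
    have h3 := summable_mul_of_summable_norm (hX'.summable X hxu hxv) (hY'.summable Y hyu hyv)
    exact (h1.mul h2 h3).mul_left (β p)
  have h' := hasSum_sum (s := s) fun p _ => h p
  simp only [← mul_assoc (β _) (X.series _ _)] at h'
  convert h' using 2 with j
  rw [Finset.sum_mul]
  refine Finset.sum_congr rfl fun p _ => ?_
  ring

/-- A bilinear combination of derivatives of total positive order has the expansion of a cusp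
form. -/
theorem exists_cusp_expansion {m ν : ℕ} (hm : 0 < m) (hν : 0 < ν) {κ₁ κ₂ : ℝ} (hκ₂ : 0 ≤ κ₂)
    {d : ℤ → ℤ → ℂ} {a : ℕ → ℂ} {B : ℍ → ℂ → ℂ} (β : ℕ × ℕ → ℂ)
    (hd : ∀ n r : ℤ, (r : ℝ) ^ 2 - 4 * m * (n + κ₁) < 0 → d n r = 0)
    (hX : (jacobiData m hm κ₁).Admissible (fun i => d i.1 i.2))
    (hY : (conjData κ₂ hκ₂).Admissible a)
    (hB : ∀ τ z, B τ z = ∑ p ∈ Finset.HasAntidiagonal.antidiagonal ν, β p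
      * (jacobiData m hm κ₁).series
          (fun i => d i.1 i.2 * ((jacobiData m hm κ₁).q i : ℂ) ^ p.1) (τ, conj (τ : ℂ), z)
      * (conjData κ₂ hκ₂).series
          (fun n => a n * ((conjData κ₂ hκ₂).q n : ℂ) ^ p.2) (τ, conj (τ : ℂ), 0)) :
    ∃ κ : ℝ, 0 ≤ κ ∧ κ < 1 ∧ ∃ d' : ℤ → ℤ → ℂ, HasSkewExpansion m κ d' B ∧
      ∀ n r : ℤ, (r : ℝ) ^ 2 - 4 * m * (n + κ) = 0 → d' n r = 0 := by
  have hm' : (0 : ℝ) < m := by exact_mod_cast hm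
  set X := jacobiData m hm κ₁ with hXdef
  set Y := conjData κ₂ hκ₂ with hYdef
  let b : (ℤ × ℤ) × ℕ → ℂ := fun j => ∑ p ∈ Finset.HasAntidiagonal.antidiagonal ν,
    β p * (d j.1.1 j.1.2 * (X.q j.1 : ℂ) ^ p.1) * (a j.2 * (Y.q j.2 : ℂ) ^ p.2)
  -- Conjugating `g` subtracts its exponents, so the bracket has exponents in `κ₁ - κ₂ + ℤ`; `t`
  -- normalises the shift to `[0, 1)`.
  let t : ℤ := ⌊κ₁ - κ₂⌋
  have ht : (t : ℝ) + Int.fract (κ₁ - κ₂) = κ₁ - κ₂ := Int.floor_add_fract _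
  let d' : ℤ → ℤ → ℂ := fun n r => ∑' N : ℕ, b (shiftEquiv t ((n, r), N))
  -- The discriminant of a product term is that of the `f`-term plus the nonnegative `4m(N + κ₂)`;
  -- both the support and the cusp condition follow from this.
  have hD (n r : ℤ) (N : ℕ) : (r : ℝ) ^ 2 - 4 * m * (n + Int.fract (κ₁ - κ₂)) =
      ((r : ℝ) ^ 2 - 4 * m * ((n + N - t : ℤ) + κ₁)) + 4 * m * (N + κ₂) := by
    push_cast
    linear_combination (-4 * (m : ℝ)) * ht
  have hN (N : ℕ) : 0 ≤ 4 * m * (N + κ₂) := by positivity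
  have hb (j : (ℤ × ℤ) × ℕ) (h : d j.1.1 j.1.2 = 0) : b j = 0 := by simp [b, h]
  refine ⟨Int.fract (κ₁ - κ₂), Int.fract_nonneg _, Int.fract_lt_one _, d', ⟨?_, ?_⟩, ?_⟩
  · intro n r h
    have h0 (N : ℕ) : b (shiftEquiv t ((n, r), N)) = 0 := by
      refine hb _ (hd _ _ ?_)
      have := hN N
      rw [hD n r N] at h
      simp only [shiftEquiv, Equiv.coe_fn_mk]
      linarith
    simp only [d', h0, tsum_zero]
  · intro τ z
    have h1 : HasSum (fun j : (ℤ × ℤ) × ℕ => b j *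
        (Complex.exp (X.form j.1 (τ, conj (τ : ℂ), z)) *
          Complex.exp (Y.form j.2 (τ, conj (τ : ℂ), 0)))) (B τ z) := by
      have hu : 0 < ((τ, conj (τ : ℂ), z) : ℂ × ℂ × ℂ).1.im := τ.im_pos
      have hv : ((τ, conj (τ : ℂ), z) : ℂ × ℂ × ℂ).2.1.im < 0 := by simpa using τ.im_pos
      rw [hB]
      exact hasSum_bilinear X Y hX hY _ β hu hv hu hv
    rw [← (shiftEquiv t).hasSum_iff] at h1
    have h2 (j : (ℤ × ℤ) × ℕ) : b (shiftEquiv t j) *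
        (Complex.exp (X.form (shiftEquiv t j).1 (τ, conj (τ : ℂ), z)) *
          Complex.exp (Y.form (shiftEquiv t j).2 (τ, conj (τ : ℂ), 0))) =
        b (shiftEquiv t j) *
        (Complex.exp (((-(Real.pi * τ.im / m) *
            ((j.1.2 : ℝ) ^ 2 - 4 * m * (j.1.1 + Int.fract (κ₁ - κ₂))) : ℝ)) : ℂ)
          * Complex.exp (2 * Real.pi * Complex.I *
            ((j.1.1 : ℂ) + (Int.fract (κ₁ - κ₂) : ℝ)) * τ)
          * Complex.exp (2 * Real.pi * Complex.I * j.1.2 * z)) := by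
      obtain ⟨⟨n, r⟩, N⟩ := j
      rcases lt_or_ge ((r : ℝ) ^ 2 - 4 * m * ((n + N - t : ℤ) + κ₁)) 0 with h | h
      · rw [hb _ (hd _ _ h), zero_mul, zero_mul]
      · congr 1
        have h3 := skew_term_eq m hm (n + Int.fract (κ₁ - κ₂)) r τ z
        rw [hD n r N] at h3
        simp only [hD n r N]
        push_cast at h3 ⊢
        rw [h3, ← Complex.exp_add, ExpData.form_apply, ExpData.form_apply]
        simp only [hXdef, hYdef, jacobiData, conjData, shiftEquiv, Equiv.coe_fn_mk,
          max_eq_left h]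
        congr 1
        have hmc : (m : ℂ) ≠ 0 := by exact_mod_cast hm.ne'
        push_cast
        field_simp
        ring
    have h4 := h1.congr_fun (fun j => (h2 j).symm)
    have h5 := h4.prod_fiberwise fun i => (h4.summable.prod_factor i).hasSum
    refine h5.congr_fun fun i => ?_
    simp only [tsum_mul_right, d', mul_assoc]
  · intro n r h
    have h0 (N : ℕ) : b (shiftEquiv t ((n, r), N)) = 0 := by
      rcases lt_or_ge ((r : ℝ) ^ 2 - 4 * m * ((n + N - t : ℤ) + κ₁)) 0 with h' | h'
      · exact hb _ (hd _ _ h')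
      · have := hN N
        rw [hD n r N] at h
        have e1 : X.q (n + N - t, r) = 0 := by
          simp only [hXdef, jacobiData, max_eq_left h']
          rw [show (r : ℝ) ^ 2 - 4 * m * ((n + N - t : ℤ) + κ₁) = 0 by linarith, zero_div]
        have e2 : Y.q N = 0 := by
          simp only [hYdef, conjData]
          have : 4 * m * (N + κ₂) = 0 := by linarith
          simpa [hm.ne'] using this
        simp only [b, shiftEquiv, Equiv.coe_fn_mk, e1, e2]
        refine Finset.sum_eq_zero fun p hp => ?_
        rw [Finset.HasAntidiagonal.mem_antidiagonal] at hp
        -- As `p.1 + p.2 = ν > 0`, at least one of the powers of zero is positive.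
        rcases Nat.eq_zero_or_pos p.1 with h1 | h1
        · simp [show p.2 ≠ 0 by omega]
        · simp [h1.ne']
    simp only [d', h0, tsum_zero]

/-! ### Multiplier systems, analyticity and assembly of the theorem. -/

/-- On the unit circle conjugation is inversion, so the cocycle identity is the quotient of the two
given ones. -/
theorem IsMultiplierSystem.mul_conj {w l : ℝ} {χ₁ χ₂ : SL(2, ℤ) → ℂ}
    (h₁ : IsMultiplierSystem w χ₁) (h₂ : IsMultiplierSystem l χ₂) :
    IsMultiplierSystem (w - l) (fun γ => χ₁ γ * conj (χ₂ γ)) where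
  norm_eq_one γ := by simp [h₁.norm_eq_one, h₂.norm_eq_one]
  cocycle γ₁ γ₂ τ := by
    have hn (γ : SL(2, ℤ)) : χ₂ γ ≠ 0 := by
      rw [← norm_pos_iff, h₂.norm_eq_one]
      exact one_pos
    have hinv (γ : SL(2, ℤ)) : conj (χ₂ γ) = (χ₂ γ)⁻¹ := by
      rw [Complex.inv_eq_conj (h₂.norm_eq_one γ)]
    have hj (γ : SL(2, ℤ)) (τ : ℍ) : autFactor γ τ ^ (l : ℂ) ≠ 0 := by
      simp [Complex.cpow_eq_zero_iff, autFactor_ne_zero]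
    push_cast
    simp only [hinv, Complex.cpow_sub _ _ (autFactor_ne_zero _ _)]
    have e₁ := h₁.cocycle γ₁ γ₂ τ
    have e₂ := h₂.cocycle γ₁ γ₂ τ
    calc _ = χ₁ (γ₁ * γ₂) * autFactor (γ₁ * γ₂) τ ^ (w : ℂ) /
          (χ₂ (γ₁ * γ₂) * autFactor (γ₁ * γ₂) τ ^ (l : ℂ)) := by
          field_simp [hn, hj]
      _ = _ := by
          rw [e₁, e₂]
          field_simp [hn, hj]

/-- This is the source of the weight `k - 1/2`: writing `|x|` as `x^(1/2)` times its conjugate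
leaves one factor holomorphic in `x` and one antiholomorphic. -/
theorem norm_mul_conj_cpow {x : ℂ} (hx : x ≠ 0) (k : ℝ) :
    x ^ (1 / 2 : ℂ) * conj (x ^ ((k - 1 / 2 : ℝ) : ℂ)) =
      (‖x‖ : ℂ) * (conj (x ^ (1 - (k : ℂ))))⁻¹ := by
  have h1 : ((k - 1 / 2 : ℝ) : ℂ) = 1 / 2 + -(1 - (k : ℂ)) := by push_cast; ring
  rw [h1, Complex.cpow_add _ _ hx, Complex.cpow_neg, map_mul, ← mul_assoc, Complex.mul_conj,
    map_inv₀, Complex.normSq_eq_norm_sq]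
  have h2 := Complex.norm_cpow_real x (1 / 2)
  push_cast at h2
  rw [h2, ← Real.rpow_natCast, ← Real.rpow_mul (norm_nonneg x)]
  norm_num

theorem antiD_analytic {F : ℍ → ℂ}
    (hF : AnalyticOnNhd ℝ (fun w : ℂ => F (ofComplex w)) {w : ℂ | 0 < w.im}) :
    AnalyticOnNhd ℝ (fun w : ℂ => antiD F (ofComplex w)) {w : ℂ | 0 < w.im} := by
  have ho : IsOpen {w : ℂ | 0 < w.im} := isOpen_lt continuous_const Complex.continuous_im
  have h (v : ℂ) : AnalyticOnNhd ℝ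
      (fun w => fderiv ℝ (fun w : ℂ => F (ofComplex w)) w v) {w : ℂ | 0 < w.im} := fun w hw =>
    ((ContinuousLinearMap.apply ℝ ℂ v).analyticAt _).comp (hF.fderiv w hw)
  refine AnalyticOnNhd.congr ho (f := fun w => -(1 / (2 * Real.pi * Complex.I)) * ((1 / 2) *
      (fderiv ℝ (fun w : ℂ => F (ofComplex w)) w 1
        + Complex.I * fderiv ℝ (fun w : ℂ => F (ofComplex w)) w Complex.I))) ?_ ?_
  · exact analyticOnNhd_const.mul (analyticOnNhd_const.mul
      ((h 1).add (analyticOnNhd_const.mul (h Complex.I))))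
  · intro w hw
    simp only [antiD, wirtingerBar, ofComplex_apply_of_im_pos hw]

theorem iterate_antiD_analytic {F : ℍ → ℂ}
    (hF : AnalyticOnNhd ℝ (fun w : ℂ => F (ofComplex w)) {w : ℂ | 0 < w.im}) (r : ℕ) :
    AnalyticOnNhd ℝ (fun w : ℂ => antiD^[r] F (ofComplex w)) {w : ℂ | 0 < w.im} := by
  induction r with
  | zero => exact hF
  | succ r ih =>
    simp only [Function.iterate_succ_apply']
    exact antiD_analytic ih

theorem IsModularForm.conj_analytic {l : ℝ} {χ : SL(2, ℤ) → ℂ} {g : ℍ → ℂ}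
    (hg : IsModularForm l χ g) :
    AnalyticOnNhd ℝ (fun w : ℂ => conj (g (ofComplex w))) {w : ℂ | 0 < w.im} := by
  have ho : IsOpen {w : ℂ | 0 < w.im} := isOpen_lt continuous_const Complex.continuous_im
  intro w hw
  exact (Complex.conjCLE.toContinuousLinearMap.analyticAt _).comp
    ((hg.holomorphic.analyticOnNhd ho w hw).restrictScalars (𝕜 := ℝ))

theorem skewBracket_eq (k l : ℝ) (ν : ℕ) (f : ℍ → ℂ → ℂ) (g : ℍ → ℂ) (τ : ℍ) (z : ℂ) :
    skewBracket k l ν f g τ z = ∑ p ∈ Finset.HasAntidiagonal.antidiagonal ν,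
      bracketCoeff (k - 1 / 2) l ν p * antiD^[p.1] (fun τ' => f τ' z) τ
        * antiD^[p.2] (fun τ' => conj (g τ')) τ := by
  simp only [skewBracket, bracketCoeff]
  rw [show (ν : ℝ) + k - 3 / 2 = ν + (k - 1 / 2) - 1 by ring]

/-- The exponential factor in the action of the Jacobi group. -/
def jacobiExp (m : ℕ) (γ : SL(2, ℤ)) (lam mu : ℤ) (z w : ℂ) : ℂ :=
  Complex.exp (2 * Real.pi * Complex.I * m *
    (-(((γ 1 0 : ℤ) : ℂ) * (z + lam * w + mu) ^ 2 /
        (((γ 1 0 : ℤ) : ℂ) * w + ((γ 1 1 : ℤ) : ℂ)))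
      + (lam : ℂ) ^ 2 * w + 2 * lam * z))

theorem differentiableAt_jacobiExp (m : ℕ) (γ : SL(2, ℤ)) (lam mu : ℤ) (z : ℂ) (τ : ℍ) :
    DifferentiableAt ℂ (jacobiExp m γ lam mu z) τ := by
  have h := autFactor_ne_zero γ τ
  rw [autFactor] at h
  unfold jacobiExp
  fun_prop (disch := exact h)

theorem isSkewJacobiCuspForm_skewBracket
    (k l : ℝ) (m ν : ℕ) (hm : 0 < m) (hν : 0 < ν) (χ₁ χ₂ : SL(2, ℤ) → ℂ)
    (h₁ : ∀ γ, ‖χ₁ γ‖ = 1) (h₂ : ∀ γ, ‖χ₂ γ‖ = 1)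
    (f : ℍ → ℂ → ℂ) (hf : IsSkewJacobiForm k m χ₁ f)
    (g : ℍ → ℂ) (hg : IsModularForm l χ₂ g) :
    IsSkewJacobiCuspForm (k + l + 2 * ν) m (fun γ => χ₁ γ * conj (χ₂ γ))
      (skewBracket k l ν f g) := by
  obtain ⟨κ₁, -, -, d, hd⟩ := hf.fourier
  obtain ⟨κ₂, hκ₂, -, -, a, ha⟩ := hg.fourier
  obtain ⟨hX, hfX⟩ := hd.series hm
  obtain ⟨hY, hgY⟩ := conj_eq_series hκ₂ ha
  have hd1 := hd.1
  generalize hXdef : jacobiData m hm κ₁ = X at hX hfX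
  generalize hYdef : conjData κ₂ hκ₂ = Y at hY hgY
  generalize hcdef : (fun i : ℤ × ℤ => d i.1 i.2) = c at hX hfX
  generalize hcdef' : (fun n => conj (a n)) = c' at hY hgY
  have hF (z : ℂ) := hX.hasAntiD_diagonal X z
  have hG := hY.hasAntiD_diagonal Y 0
  have hFi (z : ℂ) (r : ℕ) : antiD^[r] (fun τ => f τ z) =
      fun τ : ℍ => X.series (fun i => c i * (X.q i : ℂ) ^ r) (τ, conj (τ : ℂ), z) := by
    rw [← iterate_antiD (hF z) r]
    congr 1
    ext τ
    simp [hfX]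
  have hGi (r : ℕ) : antiD^[r] (fun τ => conj (g τ)) =
      fun τ : ℍ => Y.series (fun i => c' i * (Y.q i : ℂ) ^ r) (τ, conj (τ : ℂ), 0) := by
    rw [← iterate_antiD hG r]
    congr 1
    ext τ
    simp [hgY]
  have hB (τ : ℍ) (z : ℂ) : skewBracket k l ν f g τ z =
      ∑ p ∈ Finset.HasAntidiagonal.antidiagonal ν, bracketCoeff (k - 1 / 2) l ν p
        * X.series (fun i => c i * (X.q i : ℂ) ^ p.1) (τ, conj (τ : ℂ), z)
        * Y.series (fun n => c' n * (Y.q n : ℂ) ^ p.2) (τ, conj (τ : ℂ), 0) := by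
    rw [skewBracket_eq]
    simp only [hFi, hGi]
  refine ⟨⟨fun z => ?_, fun τ => ?_, fun γ lam mu τ z => ?_⟩, ?_⟩
  · simp only [skewBracket_eq]
    refine Finset.analyticOnNhd_fun_sum _ fun p _ => ?_
    exact (analyticOnNhd_const.mul (iterate_antiD_analytic (hf.analytic z) p.1)).mul
      (iterate_antiD_analytic hg.conj_analytic p.2)
  · have : skewBracket k l ν f g τ = fun z => _ := funext (hB τ)
    rw [this]
    refine Differentiable.fun_sum fun p _ => ?_
    exact (((hX.mul_q_pow X p.1).differentiable_right X τ.im_pos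
      (by simpa using τ.im_pos)).const_mul _).mul_const _
  · have hj := autFactor_ne_zero γ τ
    -- `H` collects every factor holomorphic in `τ`. The translation `mu` is absorbed into `z`.
    have t₁ := deriv_transformation (γ := γ) (K := k - 1 / 2) (τ := τ)
      (H := fun w => χ₁ γ * (((γ 1 0 : ℤ) : ℂ) * w + ((γ 1 1 : ℤ) : ℂ)) ^ (1 / 2 : ℂ) *
        (jacobiExp m γ lam mu z w)⁻¹)
      (fun τ => ((hasDerivAt_autFactor_cpow γ (1 / 2) τ).differentiableAt.const_mul _).mul
        ((differentiableAt_jacobiExp m γ lam mu z τ).inv (Complex.exp_ne_zero _)))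
      (hF z) (hX.hasAntiD_smul X γ lam (z + mu)) (fun τ => by
        have h := hf.slash_invariant γ lam mu τ z
        have hj := autFactor_ne_zero γ τ
        have hE : jacobiExp m γ lam mu z τ ≠ 0 := Complex.exp_ne_zero _
        have hχ : χ₁ γ ≠ 0 := by
          rw [← norm_pos_iff, h₁]; exact one_pos
        have hn : (‖autFactor γ τ‖ : ℂ) ≠ 0 := by simpa using hj
        have hp : conj (autFactor γ τ ^ (1 - (k : ℂ))) ≠ 0 := by
          simp [Complex.cpow_eq_zero_iff, hj]
        have key := norm_mul_conj_cpow hj k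
        simp only [pow_zero, mul_one, ← hfX]
        rw [skewSlash] at h
        change _ * _ * _ * _ * jacobiExp m γ lam mu z τ = _ at h
        rw [add_right_comm z] at h
        change _ = χ₁ γ * autFactor γ τ ^ (1 / 2 : ℂ) * (jacobiExp m γ lam mu z τ)⁻¹ *
          conj (autFactor γ τ ^ ((k - 1 / 2 : ℝ) : ℂ)) * f τ z
        rw [← h]
        calc _ = χ₁ γ * ((‖autFactor γ τ‖ : ℂ) * (conj (autFactor γ τ ^ (1 - (k : ℂ))))⁻¹) *
              (jacobiExp m γ lam mu z τ)⁻¹ * ((χ₁ γ)⁻¹ *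
                f (γ • τ) ((z + mu + lam * (τ : ℂ)) / autFactor γ τ) *
                conj (autFactor γ τ ^ (1 - (k : ℂ))) * (‖autFactor γ τ‖ : ℂ)⁻¹ *
                jacobiExp m γ lam mu z τ) := by field_simp
          _ = _ := by rw [← key]; ring)
    -- For `conj g` the series has `ρ = 0`, so the Möbius lemma is applied with `lam = 0` and `z =
    -- 0`.
    have t₂ := deriv_transformation (γ := γ) (K := l) (τ := τ) (H := fun _ => conj (χ₂ γ))
      (fun τ => differentiableAt_const _) hG
      (G := fun r τ => Y.series (fun i => c' i * (Y.q i : ℂ) ^ r)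
        ((γ • τ : ℍ), conj ((γ • τ : ℍ) : ℂ), 0))
      (fun r τ => by simpa using hY.hasAntiD_smul Y γ 0 0 r τ) (fun τ => by
        have h := hg.slash_invariant γ τ
        have hj := autFactor_ne_zero γ τ
        have hχ : χ₂ γ ≠ 0 := by
          rw [← norm_pos_iff, h₂]; exact one_pos
        have hp : autFactor γ τ ^ (l : ℂ) ≠ 0 := by
          simp [Complex.cpow_eq_zero_iff, hj]
        simp only [pow_zero, mul_one, ← hgY]
        rw [← map_mul, ← map_mul, ← h, Complex.cpow_neg]
        congr 1
        field_simp)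
    have t := bracket_transformation t₁ t₂ ν
    rw [← hB, ← hB, add_right_comm z] at t
    have hE : jacobiExp m γ lam mu z τ ≠ 0 := Complex.exp_ne_zero _
    have hχ₁ : χ₁ γ ≠ 0 := by
      rw [← norm_pos_iff, h₁]; exact one_pos
    have hχ₂ : conj (χ₂ γ) ≠ 0 := by
      rw [← norm_pos_iff, RCLike.norm_conj, h₂]; exact one_pos
    have hn : (‖autFactor γ τ‖ : ℂ) ≠ 0 := by simpa using hj
    have hp : conj (autFactor γ τ ^ (1 - (k : ℂ))) ≠ 0 := by
      simp [Complex.cpow_eq_zero_iff, hj]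
    have hl : conj (autFactor γ τ ^ (l : ℂ)) ≠ 0 := by
      simp [Complex.cpow_eq_zero_iff, hj]
    have hjc : conj (autFactor γ τ) ≠ 0 := by simpa using hj
    have key := norm_mul_conj_cpow hj k
    have hexp : conj (autFactor γ τ ^ (1 - ((k + l + 2 * ν : ℝ) : ℂ))) =
        conj (autFactor γ τ ^ (1 - (k : ℂ))) * (conj (autFactor γ τ ^ (l : ℂ)))⁻¹ *
          (conj (autFactor γ τ) ^ (2 * ν))⁻¹ := by
      rw [show 1 - ((k + l + 2 * ν : ℝ) : ℂ) = (1 - (k : ℂ)) + -(l : ℂ) + -((2 * ν : ℕ) : ℂ) by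
        push_cast; ring, Complex.cpow_add _ _ hj, Complex.cpow_add _ _ hj, Complex.cpow_neg,
        Complex.cpow_neg, Complex.cpow_natCast]
      simp only [map_mul, map_inv₀, map_pow]
    change _ * _ * _ * _ * jacobiExp m γ lam mu z τ = _
    rw [t, hexp]
    change (χ₁ γ * conj (χ₂ γ))⁻¹ * (χ₁ γ * autFactor γ τ ^ (1 / 2 : ℂ) *
      (jacobiExp m γ lam mu z τ)⁻¹ * conj (autFactor γ τ ^ ((k - 1 / 2 : ℝ) : ℂ)) *
      _ * _ * _) * _ * _ * _ = _
    calc _ = (χ₁ γ)⁻¹ * (conj (χ₂ γ))⁻¹ * χ₁ γ * conj (χ₂ γ) *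
          (autFactor γ τ ^ (1 / 2 : ℂ) * conj (autFactor γ τ ^ ((k - 1 / 2 : ℝ) : ℂ))) *
          ((jacobiExp m γ lam mu z τ)⁻¹ * jacobiExp m γ lam mu z τ) *
          conj (autFactor γ τ ^ (1 - (k : ℂ))) * (‖autFactor γ τ‖ : ℂ)⁻¹ *
          (conj (autFactor γ τ ^ (l : ℂ)) * (conj (autFactor γ τ ^ (l : ℂ)))⁻¹) *
          (conj (autFactor γ τ) ^ (2 * ν) * (conj (autFactor γ τ) ^ (2 * ν))⁻¹) *
          skewBracket k l ν f g τ z := by rw [mul_inv]; ring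
      _ = _ := by rw [key]; field_simp
  · subst hXdef hYdef hcdef hcdef'
    exact exists_cusp_expansion hm hν hκ₂ _ hd1 hX hY hB

end SkewJacobi

end

theorem mainTheorem10
    (k l w : ℝ) (m ν : ℕ) (hm : 0 < m) (hν : 0 < ν)
    (χ₁ χ₂ : SL(2, ℤ) → ℂ)
    (hχ₁ : SkewJacobi.IsMultiplierSystem w χ₁)
    (hχ₂ : SkewJacobi.IsMultiplierSystem l χ₂)
    (f : ℍ → ℂ → ℂ) (hf : SkewJacobi.IsSkewJacobiForm k m χ₁ f)
    (g : ℍ → ℂ) (hg : SkewJacobi.IsModularForm l χ₂ g) :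
    SkewJacobi.IsMultiplierSystem (w - l) (fun γ => χ₁ γ * conj (χ₂ γ)) ∧
    SkewJacobi.IsSkewJacobiCuspForm (k + l + 2 * ν) m (fun γ => χ₁ γ * conj (χ₂ γ))
      (SkewJacobi.skewBracket k l ν f g) :=
  ⟨hχ₁.mul_conj hχ₂, SkewJacobi.isSkewJacobiCuspForm_skewBracket k l m ν hm hν χ₁ χ₂
    hχ₁.norm_eq_one hχ₂.norm_eq_one f hf g hg⟩
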